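/- Let $U,V\in L^\infty(\mathbb R)$ be real-valued functions with compact support, and suppose in addition that $V\in W_2^1(\mathbb R)$. Let $\alpha_\lambda>0$ for $\lambda>0$, and put $H_0=-\frac{d^2}{dx^2}+U$ and $H_\lambda=H_0+\lambda\alpha_\lambda V(\alpha_\lambda\,\cdot)$ in $L_2(\mathbb R)$, with domain $W_2^2(\mathbb R)$. Suppose that $H_0$ has a zero-energy resonance, that is, $-h''+Uh=0$ has a non-trivial solution bounded on $\mathbb R$; let $u$ be the normalized half-bound state, that is, the bounded solution with $\lim_{x\to-\infty}u(x)=1$, and let $\theta=\lim_{x\to+\infty}u(x)$. Suppose that $\alpha_\lambda\to\alpha$ as $\lambda\to0^+$ for some $\alpha>0$, that $$\int_{\mathbb R}V(\alpha x)\,u(x)^2\,dx=0,\qquad \int_{\mathbb R}x\,V'(\alpha x)\,u(x)^2\,dx<0,$$ and that $\lambda^{-1/3}(\alpha_\lambda-\alpha)\to+\infty$ as $\lambda\to0^+$. Then the family $H_\lambda$ has the coupling constant threshold $\lambda=0$: there is a gap $(a,0)$, $a<0$, in the spectrum of $H_0$, with $0$ in the spectrum of $H_0$, such that for all sufficiently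 small $\lambda>0$ there is an eigenvalue $e_\lambda\in(a,0)$ of $H_\lambda$, with $e_\lambda\to0$ as $\lambda\to0^+$. Moreover, the threshold eigenvalue, that is, any family of negative eigenvalues $e_\lambda$ of $H_\lambda$ (defined for small $\lambda>0$) with $e_\lambda\to0$, satisfies $$e_\lambda=-\lambda^2(\alpha_\lambda-\alpha)^2\left(\left(\frac{\alpha}{\theta^2+1}\int_{\mathbb R}x\,V'(\alpha x)\,u(x)^2\,dx\right)^2+o(1)\right)\qquad\text{as }\lambda\to0^+.$$ -/

import Mathlib

open MeasureTheory Filter Topology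
open scoped NNReal ContDiff

namespace CouplingThreshold

/-- `g` is the weak (distributional) derivative of `f` on the real line. -/
def HasWeakDeriv {E : Type*} [NormedAddCommGroup E] [NormedSpace ℝ E] (f g : ℝ → E) : Prop :=
  LocallyIntegrable f volume ∧ LocallyIntegrable g volume ∧
    ∀ φ : ℝ → ℝ, ContDiff ℝ ∞ φ → HasCompactSupport φ →
      ∫ x, deriv φ x • f x = -∫ x, φ x • g x

/-- A real potential of class `L^∞(ℝ)` with compact (essential) support. -/
def IsPotential (q : ℝ → ℝ) : Prop :=
  MemLp q ⊤ volume ∧ ∃ R : ℝ, ∀ᵐ x : ℝ, R < |x| → q x = 0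

/-- The graph of the Schrödinger operator `H = -d²/dx² + q` in `L²(ℝ; ℂ)` with domain the Sobolev
space `W₂²(ℝ)`: the function `ψ` belongs to `W₂²(ℝ)`, and `H ψ = f` in `L²(ℝ; ℂ)`. -/
def SchrodingerGraph (q : ℝ → ℝ) (ψ f : ℝ → ℂ) : Prop :=
  ∃ ψ₁ ψ₂ : ℝ → ℂ,
    MemLp ψ 2 volume ∧ MemLp ψ₁ 2 volume ∧ MemLp ψ₂ 2 volume ∧
    HasWeakDeriv ψ ψ₁ ∧ HasWeakDeriv ψ₁ ψ₂ ∧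
    MemLp f 2 volume ∧ ∀ᵐ x : ℝ, f x = -ψ₂ x + (q x : ℂ) * ψ x

/-- The real number `e` is an eigenvalue of `-d²/dx² + q`. -/
def IsEigenvalue (q : ℝ → ℝ) (e : ℝ) : Prop :=
  ∃ ψ : ℝ → ℂ, ¬ (ψ =ᵐ[volume] 0) ∧ SchrodingerGraph q ψ (fun x => (e : ℂ) * ψ x)

/-- The real number `z` belongs to the resolvent set of `H = -d²/dx² + q`: the operator `H - z`
maps `W₂²(ℝ)` onto `L²(ℝ; ℂ)`, and it has a bounded inverse. -/
def InResolventSet (q : ℝ → ℝ) (z : ℝ) : Prop :=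
  (∀ g : ℝ → ℂ, MemLp g 2 volume →
    ∃ ψ : ℝ → ℂ, SchrodingerGraph q ψ (fun x => g x + (z : ℂ) * ψ x)) ∧
  ∃ C : ℝ≥0, ∀ ψ f : ℝ → ℂ, SchrodingerGraph q ψ f →
    eLpNorm ψ 2 volume ≤ C * eLpNorm (fun x => f x - (z : ℂ) * ψ x) 2 volume

/-- The interval `(a, 0)` is a gap in the spectrum of `-d²/dx² + q`, adjacent to the point `0` of
the spectrum. -/
def IsGapBelowZero (q : ℝ → ℝ) (a : ℝ) : Prop :=
  a < 0 ∧ (∀ z ∈ Set.Ioo a 0, InResolventSet q z) ∧ ¬ InResolventSet q 0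

/-- `e` is a threshold eigenvalue of the family `-d²/dx² + U + W_l`, `l > 0`: for all small `l > 0`
the number `e l` is a negative eigenvalue, and `e l → 0` as `l → 0`. -/
def IsThresholdEigenvalue (U : ℝ → ℝ) (W : ℝ → ℝ → ℝ) (e : ℝ → ℝ) : Prop :=
  (∀ᶠ l in 𝓝[>] (0 : ℝ), e l < 0 ∧ IsEigenvalue (fun x => U x + W l x) (e l)) ∧
    Tendsto e (𝓝[>] 0) (𝓝 0)

/-- The family `-d²/dx² + U + W_l`, `l > 0`, with potentials `U` and `W_l` which are bounded and
have compact support, has the coupling constant threshold `l = 0`: for all small `l > 0` there is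
an eigenvalue `e l` in a gap `(a, 0)` of the spectrum of `-d²/dx² + U`, with `e l → 0 - 0`. -/
def HasCouplingConstantThreshold (U : ℝ → ℝ) (W : ℝ → ℝ → ℝ) : Prop :=
  ∃ a : ℝ, IsGapBelowZero U a ∧
    ∃ e : ℝ → ℝ, IsThresholdEigenvalue U W e ∧ ∀ᶠ l in 𝓝[>] (0 : ℝ), e l ∈ Set.Ioo a 0

/-- `h` is a solution of `-h'' + U h = 0` on the real line: it is continuously differentiable, and
its derivative is absolutely continuous with `(h')' = U h` almost everywhere. -/
def IsZeroEnergySolution (U h : ℝ → ℝ) : Prop :=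
  ∃ h₁ : ℝ → ℝ, (∀ x, HasDerivAt h (h₁ x) x) ∧
    ∀ a b : ℝ, h₁ b - h₁ a = ∫ x in a..b, U x * h x

/-- `u` is the normalized half-bound state of `-d²/dx² + U` (which thus has a zero-energy
resonance), with limit `1` at `-∞` and limit `θ` at `+∞`. -/
def IsNormalizedHalfBoundState (U u : ℝ → ℝ) (θ : ℝ) : Prop :=
  IsZeroEnergySolution U u ∧ (∃ M : ℝ, ∀ x, |u x| ≤ M) ∧
    Tendsto u atBot (𝓝 1) ∧ Tendsto u atTop (𝓝 θ)

end CouplingThreshold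

/-!
The proof is a shooting argument. Modulo a.e. changes, all potentials vanish outside one interval
`[-R, R]`, and for `k > 0` the equation `-ψ'' + q ψ = -k² ψ` has, up to a factor, a single
solution `φ` which decays at `-∞` (`IsLeftJost`: `φ(-R) = 1`, `φ'(-R) = k`). It lies in `L²` iff
the Jost function `D(k) = φ'(R) + k φ(R)` vanishes, so the zeros `k > 0` of `D` are exactly the
eigenvalues `-k²` (`isEigenvalue_iff`), and where `D(k) ≠ 0` Green's function inverts the operator
with an `L²` bound (`inResolventSet_of_ne`).

For `q = U + W` with `|W| ≤ ε`, the Wronskian of `φ` with the half-bound state `u`, together with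
the Gronwall estimate `φ = u + O(ε + k)` on `[-R, R]`, gives
`θ D(k) = k (1 + θ²) + ∫ W u² + O((ε + k)²)` (`IsHalfBound.exists_jost_expansion`). With `W = 0` this shows that `D` has no small
positive zeros for `U` itself, which is the spectral gap; that `0` belongs to the spectrum is a
flux argument (`IsHalfBound.not_inResolventSet_zero`).

For `W = l α_l V(α_l ·)` the first order term is `l α_l G(α_l)` with `G(a) = ∫ V(a x) u(x)² dx`.
Here `G(α₀) = 0` and `G'(α₀) = ∫ x V'(α₀ x) u(x)² dx < 0` (`hasDerivAt_integral_comp_mul`), so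
that term is `l α₀ (α_l - α₀) (G'(α₀) + o(1))`. The rate hypothesis makes `l²` negligible against
`l (α_l - α₀)`. Hence `D` changes sign near `k = -l (α_l - α₀) α₀ G'(α₀) / (1 + θ²)`, which yields
the eigenvalue, and every zero `k → 0` has this leading term (`tendsto_div_of_abs_le`).

Differential equations with merely bounded coefficients are handled through `IsPrimitive`: a pair
of a function and a locally integrable function it is an integral of, related to `HasWeakDeriv` by
the lemma of du Bois-Reymond.
-/

namespace CouplingThreshold

/-! ### Primitives of locally integrable functions -/

variable {E : Type*} [NormedAddCommGroup E] [NormedSpace ℝ E]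

/-- `f` is a primitive of the locally integrable function `g`. This is the classical form of
`HasWeakDeriv`: the absolutely continuous function `f` is pinned at every point, while `g` matters
only almost everywhere. -/
structure IsPrimitive (f g : ℝ → E) : Prop where
  locallyIntegrable : LocallyIntegrable g volume
  sub_eq : ∀ a b, f b - f a = ∫ x in a..b, g x

lemma _root_.MeasureTheory.LocallyIntegrable.intervalIntegrable' {E : Type*}
    [NormedAddCommGroup E] {g : ℝ → E}
    (hg : LocallyIntegrable g volume) (a b : ℝ) : IntervalIntegrable g volume a b :=
  (hg.integrableOn_isCompact isCompact_uIcc).intervalIntegrable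

namespace IsPrimitive

variable {f f' g g' : ℝ → E}

lemma intervalIntegrable (h : IsPrimitive f g) (a b : ℝ) : IntervalIntegrable g volume a b :=
  h.locallyIntegrable.intervalIntegrable' a b

lemma eq_add (h : IsPrimitive f g) (a b : ℝ) : f b = f a + ∫ x in a..b, g x := by
  rw [← h.sub_eq a b]; abel

lemma integral (hg : LocallyIntegrable g volume) (a : ℝ) (c : E) :
    IsPrimitive (fun x => c + ∫ t in a..x, g t) g := by
  refine ⟨hg, fun x y => ?_⟩
  rw [← intervalIntegral.integral_interval_sub_left (hg.intervalIntegrable' a y)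
    (hg.intervalIntegrable' a x)]
  abel

lemma congr_ae (h : IsPrimitive f g) (hgg' : g =ᵐ[volume] g') : IsPrimitive f g' := by
  refine ⟨h.locallyIntegrable.congr hgg', fun a b => ?_⟩
  rw [h.sub_eq]
  exact intervalIntegral.integral_congr_ae (by filter_upwards [hgg'] with x hx _ using hx)

lemma congr (h : IsPrimitive f g) (hgg' : ∀ x, g x = g' x) : IsPrimitive f g' :=
  h.congr_ae (.of_forall hgg')

lemma norm_sub_le (h : IsPrimitive f g) {a b : ℝ} (hab : a ≤ b) :
    ‖f b - f a‖ ≤ ∫ x in a..b, ‖g x‖ := by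
  rw [h.sub_eq]; exact intervalIntegral.norm_integral_le_integral_norm hab

lemma continuous (h : IsPrimitive f g) : Continuous f := by
  have : f = fun x => f 0 + ∫ t in (0 : ℝ)..x, g t := funext fun x => h.eq_add 0 x
  rw [this]
  exact continuous_const.add (intervalIntegral.continuous_primitive h.intervalIntegrable 0)

lemma ae_hasDerivAt [CompleteSpace E] (h : IsPrimitive f g) : ∀ᵐ x, HasDerivAt f (g x) x := by
  have : f = fun x => f 0 + ∫ t in (0 : ℝ)..x, g t := funext fun x => h.eq_add 0 x
  filter_upwards [LocallyIntegrable.ae_hasDerivAt_integral h.locallyIntegrable] with x hx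
  rw [this]
  exact (hx 0).const_add _

lemma absolutelyContinuousOnInterval (h : IsPrimitive f g) (a b : ℝ) :
    AbsolutelyContinuousOnInterval f a b := by
  -- the primitive of `‖g‖` dominates `f`
  have hn : LocallyIntegrable (fun x => ‖g x‖) volume :=
    locallyIntegrableOn_univ.1 (h.locallyIntegrable.locallyIntegrableOn _).norm
  have H := (hn.intervalIntegrable' a b).absolutelyContinuousOnInterval_intervalIntegral
    (c := a) (by simp)
  refine squeeze_zero (fun t => Finset.sum_nonneg fun _ _ => dist_nonneg) (fun t => ?_) H
  refine Finset.sum_le_sum fun i _ => ?_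
  rw [dist_comm (f _), dist_comm (∫ v in a.._, ‖g v‖), dist_eq_norm, Real.dist_eq, h.sub_eq,
    intervalIntegral.integral_interval_sub_left (hn.intervalIntegrable' _ _)
      (hn.intervalIntegrable' _ _)]
  exact intervalIntegral.norm_integral_le_abs_integral_norm

/-- An absolutely continuous function is a primitive of its almost everywhere derivative. -/
lemma of_ae_hasDerivAt [CompleteSpace E] (hf : ∀ a b, AbsolutelyContinuousOnInterval f a b)
    (hg : LocallyIntegrable g volume) (h : ∀ᵐ x, HasDerivAt f (g x) x) : IsPrimitive f g := by
  refine ⟨hg, fun a b => ?_⟩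
  have hG := integral hg a 0
  have hac := (hf a b).sub (hG.absolutelyContinuousOnInterval a b)
  obtain ⟨C, hC⟩ := hac.const_of_ae_hasDerivAt_zero (by
    filter_upwards [h, hG.ae_hasDerivAt] with x h1 h2 _
    simpa using h1.sub h2)
  have ha := hC a (by simp)
  have hb := hC b (by simp)
  simp only [Pi.sub_apply, intervalIntegral.integral_same, zero_add, sub_zero] at ha hb
  rw [ha, ← hb]
  abel

lemma of_hasDerivAt [CompleteSpace E] (h : ∀ x, HasDerivAt f (g x) x) (hg : Continuous g) :
    IsPrimitive f g :=
  ⟨hg.locallyIntegrable, fun _ _ => (intervalIntegral.integral_eq_sub_of_hasDerivAt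
    (fun x _ => h x) (hg.intervalIntegrable _ _)).symm⟩

lemma hasDerivAt [CompleteSpace E] (h : IsPrimitive f g) (hg : Continuous g) (x : ℝ) :
    HasDerivAt f (g x) x := by
  have : f = fun x => f 0 + ∫ t in (0 : ℝ)..x, g t := funext fun x => h.eq_add 0 x
  rw [this]
  exact (hg.integral_hasStrictDerivAt 0 x).hasDerivAt.const_add _

lemma const (c : E) : IsPrimitive (fun _ => c) (fun _ => 0) :=
  ⟨locallyIntegrable_zero, fun _ _ => by simp⟩

lemma add (h : IsPrimitive f g) (h' : IsPrimitive f' g') :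
    IsPrimitive (fun x => f x + f' x) (fun x => g x + g' x) := by
  refine ⟨h.locallyIntegrable.add h'.locallyIntegrable, fun a b => ?_⟩
  rw [intervalIntegral.integral_add (h.intervalIntegrable a b) (h'.intervalIntegrable a b),
    ← h.sub_eq, ← h'.sub_eq]
  abel

lemma neg (h : IsPrimitive f g) : IsPrimitive (fun x => -f x) (fun x => -g x) := by
  refine ⟨h.locallyIntegrable.neg, fun a b => ?_⟩
  rw [intervalIntegral.integral_neg, ← h.sub_eq]
  abel

lemma sub (h : IsPrimitive f g) (h' : IsPrimitive f' g') :
    IsPrimitive (fun x => f x - f' x) (fun x => g x - g' x) := by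
  simpa only [sub_eq_add_neg] using h.add h'.neg

lemma clm_comp {F : Type*} [NormedAddCommGroup F] [NormedSpace ℝ F] [CompleteSpace E]
    [CompleteSpace F] (h : IsPrimitive f g) (L : E →L[ℝ] F) :
    IsPrimitive (fun x => L (f x)) (fun x => L (g x)) := by
  refine ⟨fun x => ?_, fun a b => ?_⟩
  · obtain ⟨s, hs, hi⟩ := h.locallyIntegrable x
    exact ⟨s, hs, L.integrable_comp hi⟩
  · rw [L.intervalIntegral_comp_comm (h.intervalIntegrable a b), ← h.sub_eq, map_sub]

lemma const_smul (h : IsPrimitive f g) (c : ℝ) :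
    IsPrimitive (fun x => c • f x) (fun x => c • g x) := by
  refine ⟨h.locallyIntegrable.smul c, fun a b => ?_⟩
  rw [intervalIntegral.integral_smul, ← h.sub_eq, smul_sub]

/-- The product rule. -/
lemma smul [CompleteSpace E] {a a' : ℝ → ℝ} (ha : IsPrimitive a a') (h : IsPrimitive f g) :
    IsPrimitive (fun x => a x • f x) (fun x => a' x • f x + a x • g x) := by
  refine of_ae_hasDerivAt (fun x y => ?_) ?_ ?_
  · exact (ha.absolutelyContinuousOnInterval x y).smul (h.absolutelyContinuousOnInterval x y)
  · refine LocallyIntegrable.add ?_ ?_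
    · rw [← locallyIntegrableOn_univ]
      exact (ha.locallyIntegrable.locallyIntegrableOn _).smul_continuousOn
        isOpen_univ.isLocallyClosed h.continuous.continuousOn
    · rw [← locallyIntegrableOn_univ]
      exact (h.locallyIntegrable.locallyIntegrableOn _).continuousOn_smul
        isOpen_univ.isLocallyClosed ha.continuous.continuousOn
  · filter_upwards [ha.ae_hasDerivAt, h.ae_hasDerivAt] with x h1 h2
    rw [add_comm]
    exact h1.smul h2

lemma comp_neg (h : IsPrimitive f g) : IsPrimitive (fun x => f (-x)) (fun x => -g (-x)) := by
  refine ⟨fun x => ?_, fun a b => ?_⟩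
  · obtain ⟨s, hs, hi⟩ := h.locallyIntegrable (-x)
    refine ⟨-s, ?_, ?_⟩
    · exact continuous_neg.continuousAt hs
    · have := (Measure.measurePreserving_neg (volume : Measure ℝ)).integrableOn_comp_preimage
        (Homeomorph.neg ℝ).measurableEmbedding (f := g) (s := s)
      exact (this.2 hi).neg
  · rw [intervalIntegral.integral_neg, intervalIntegral.integral_comp_neg, ← h.sub_eq]
    abel

lemma eq_of_ae_eq_zero (h : IsPrimitive f g) {a b : ℝ} (hab : a ≤ b)
    (hg : ∀ᵐ x, x ∈ Set.Ioc a b → g x = 0) : f a = f b := by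
  rw [h.eq_add a b, intervalIntegral.integral_of_le hab, setIntegral_eq_zero_of_ae_eq_zero hg,
    add_zero]

/-- Integration by parts against a test function. -/
lemma hasWeakDeriv [CompleteSpace E] (h : IsPrimitive f g) : HasWeakDeriv f g := by
  refine ⟨h.continuous.locallyIntegrable, h.locallyIntegrable, fun φ hφ hc => ?_⟩
  have hd : Continuous (deriv φ) := hφ.continuous_deriv (by simp)
  have hφp : IsPrimitive φ (deriv φ) :=
    of_hasDerivAt (fun x => (hφ.differentiable (by simp) x).hasDerivAt) hd
  have hp := hφp.smul h
  obtain ⟨L, hL⟩ := hc.isCompact.isBounded.subset_ball 0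
  have hz : ∀ x, x ∉ Set.Ioo (-L) L → φ x = 0 := fun x hx =>
    image_eq_zero_of_notMem_tsupport fun hx' => hx (by simpa [abs_lt] using hL hx')
  have hz' : ∀ x, x ∉ Set.Ioo (-L) L → deriv φ x = 0 := fun x hx =>
    image_eq_zero_of_notMem_tsupport fun hx' => hx (by
      simpa [abs_lt] using hL (tsupport_deriv_subset (𝕜 := ℝ) hx'))
  have h1 := hp.sub_eq (-L) L
  rw [hz L (by simp), hz (-L) (by simp), intervalIntegral.integral_eq_integral_of_support_subset,
    integral_add] at h1
  · rw [eq_neg_iff_add_eq_zero, ← h1]; simp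
  · exact h.continuous.locallyIntegrable.integrable_smul_left_of_hasCompactSupport hd hc.deriv
  · exact h.locallyIntegrable.integrable_smul_left_of_hasCompactSupport hφ.continuous hc
  · intro x hx
    by_contra hx'
    have : x ∉ Set.Ioo (-L) L := fun h' => hx' ⟨h'.1, h'.2.le⟩
    exact hx (by simp [hz x this, hz' x this])

end IsPrimitive

/-- A smooth compactly supported function with vanishing integral is the derivative of a smooth
compactly supported function. -/
lemma exists_deriv_eq_of_integral_eq_zero {η : ℝ → ℝ} (hη : ContDiff ℝ ∞ η)
    (hc : HasCompactSupport η) (h0 : ∫ x, η x = 0) :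
    ∃ Φ : ℝ → ℝ, ContDiff ℝ ∞ Φ ∧ HasCompactSupport Φ ∧ deriv Φ = η := by
  obtain ⟨L, hL⟩ := hc.isCompact.isBounded.subset_ball 0
  have hz : ∀ x, x ∉ Set.Ioo (-L) L → η x = 0 := fun x hx =>
    image_eq_zero_of_notMem_tsupport fun hx' => hx (by simpa [abs_lt] using hL hx')
  have hp := IsPrimitive.integral hη.continuous.locallyIntegrable (-L) 0
  set Φ : ℝ → ℝ := fun x => 0 + ∫ t in (-L)..x, η t with hΦ
  have hd : ∀ x, HasDerivAt Φ (η x) x := hp.hasDerivAt hη.continuous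
  have hd' : deriv Φ = η := funext fun x => (hd x).deriv
  have hzero : ∫ t in (-L)..L, η t = 0 := by
    rw [intervalIntegral.integral_eq_integral_of_support_subset, h0]
    intro x hx
    by_contra hx'
    exact hx (hz x fun h' => hx' ⟨h'.1, h'.2.le⟩)
  refine ⟨Φ, ?_, ?_, hd'⟩
  · rw [contDiff_infty_iff_deriv]
    exact ⟨fun x => (hd x).differentiableAt, hd' ▸ hη⟩
  · refine HasCompactSupport.intro (isCompact_Icc (a := -L) (b := L)) fun x hx => ?_
    rcases lt_or_ge x (-L) with h | h
    · have := hp.eq_of_ae_eq_zero h.le (.of_forall fun t ht => hz t fun h' => by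
        linarith [ht.2, h'.1])
      rw [this]; simp [hΦ]
    · have hx' : L < x := by
        by_contra h'; exact hx ⟨h, not_lt.1 h'⟩
      have := hp.eq_of_ae_eq_zero hx'.le (.of_forall fun t ht => hz t fun h' => by
        linarith [ht.1, h'.2])
      rw [← this]; simp [hΦ, hzero]

/-- The lemma of du Bois-Reymond: a function with a weak derivative agrees almost everywhere with
a primitive of it. -/
lemma HasWeakDeriv.exists_isPrimitive [CompleteSpace E] {f g : ℝ → E} (h : HasWeakDeriv f g) :
    ∃ F : ℝ → E, f =ᵐ[volume] F ∧ IsPrimitive F g := by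
  obtain ⟨hf, hg, hfg⟩ := h
  have hG := IsPrimitive.integral hg 0 0
  set G : ℝ → E := fun x => 0 + ∫ t in (0 : ℝ)..x, g t
  have hGl := hG.continuous.locallyIntegrable (μ := (volume : Measure ℝ))
  have hd : LocallyIntegrable (fun x => f x - G x) volume := hf.sub hGl
  have hint : ∀ φ : ℝ → ℝ, ContDiff ℝ ∞ φ → HasCompactSupport φ →
      ∫ x, deriv φ x • (f x - G x) = 0 := by
    intro φ hφ hc
    have hcd := hφ.continuous_deriv (by simp)
    simp only [smul_sub]
    rw [integral_sub, hfg φ hφ hc, hG.hasWeakDeriv.2.2 φ hφ hc, sub_self]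
    · exact hf.integrable_smul_left_of_hasCompactSupport hcd hc.deriv
    · exact hGl.integrable_smul_left_of_hasCompactSupport hcd hc.deriv
  let b : ContDiffBump (0 : ℝ) := ⟨1, 2, by norm_num, by norm_num⟩
  let φ₀ := b.normed (volume : Measure ℝ)
  have hφ₀ : ContDiff ℝ ∞ φ₀ := b.contDiff_normed
  have hc₀ : HasCompactSupport φ₀ := b.hasCompactSupport_normed
  have h1 : ∫ x, φ₀ x = 1 := b.integral_normed
  set c := ∫ x, φ₀ x • (f x - G x) with hcdef
  have hae : ∀ᵐ x, f x - G x = c := by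
    refine ae_eq_of_integral_contDiff_smul_eq hd (locallyIntegrable_const c) fun φ hφ hc => ?_
    -- subtract a multiple of the bump to get a test function with vanishing integral
    obtain ⟨Φ, h1Φ, h2Φ, h3Φ⟩ := exists_deriv_eq_of_integral_eq_zero
      (η := fun x => φ x - (∫ y, φ y) * φ₀ x) (hφ.sub (contDiff_const.mul hφ₀))
      (hc.sub (hc₀.mul_left (f := fun _ => ∫ y, φ y))) (by
        rw [integral_sub (hφ.continuous.integrable_of_hasCompactSupport hc)
          ((hφ₀.continuous.integrable_of_hasCompactSupport hc₀).const_mul _),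
          integral_const_mul, h1, mul_one, sub_self])
    have h2 := hint Φ h1Φ h2Φ
    rw [h3Φ] at h2
    simp only [sub_smul] at h2
    have hi := hd.integrable_smul_left_of_hasCompactSupport hφ.continuous hc
    have hi₀ := hd.integrable_smul_left_of_hasCompactSupport hφ₀.continuous hc₀
    simp only [mul_smul] at h2
    rw [integral_sub hi (hi₀.fun_smul (∫ y, φ y)), integral_smul, sub_eq_zero] at h2
    rw [h2, integral_smul_const]
  refine ⟨fun x => c + G x, ?_, ?_⟩
  · filter_upwards [hae] with x hx
    rw [← hx]; abel
  · exact ((IsPrimitive.const c).add hG).congr fun x => zero_add _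

/-! ### Linear second order equations with bounded measurable coefficients -/

lemma abs_integral_le_of_abs_le_exp {h : ℝ → ℝ} {a B μ : ℝ} (hμ : 0 < μ)
    (hh : ∀ s, |h s| ≤ B * Real.exp (μ * |s - a|)) (x : ℝ) :
    |∫ s in a..x, h s| ≤ B / μ * Real.exp (μ * |x - a|) := by
  have hB : 0 ≤ B := by simpa using (abs_nonneg _).trans (hh a)
  have key : ∀ c : ℝ, 0 ≤ c → ∫ s in (0 : ℝ)..c, B * Real.exp (μ * s)
      ≤ B / μ * Real.exp (μ * c) := by
    intro c _
    have : ∀ s ∈ Set.uIcc 0 c, HasDerivAt (fun s => B / μ * Real.exp (μ * s))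
        (B * Real.exp (μ * s)) s := by
      intro s _
      have := (((hasDerivAt_id s).const_mul μ).exp).const_mul (B / μ)
      refine this.congr_deriv ?_
      simp only [id]
      field_simp
    rw [intervalIntegral.integral_eq_sub_of_hasDerivAt this
      ((by fun_prop : Continuous fun s => B * Real.exp (μ * s)).intervalIntegrable _ _)]
    have : 0 ≤ B / μ * Real.exp (μ * 0) := by positivity
    linarith
  rcases le_total a x with hx | hx
  · have h1 : |∫ s in a..x, h s| ≤ ∫ s in a..x, B * Real.exp (μ * (s - a)) := by
      refine intervalIntegral.norm_integral_le_of_norm_le (f := h) hx ?_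
        ((by fun_prop : Continuous fun s => B * Real.exp (μ * (s - a))).intervalIntegrable _ _)
      refine .of_forall fun s hs => ?_
      simpa [abs_of_pos (sub_pos.2 hs.1)] using hh s
    refine h1.trans ?_
    rw [abs_of_nonneg (sub_nonneg.2 hx),
      intervalIntegral.integral_comp_sub_right (fun s => B * Real.exp (μ * s)) a, sub_self]
    exact key _ (sub_nonneg.2 hx)
  · rw [intervalIntegral.integral_symm, abs_neg]
    have h1 : |∫ s in x..a, h s| ≤ ∫ s in x..a, B * Real.exp (μ * (a - s)) := by
      refine intervalIntegral.norm_integral_le_of_norm_le (f := h) hx ?_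
        ((by fun_prop : Continuous fun s => B * Real.exp (μ * (a - s))).intervalIntegrable _ _)
      refine .of_forall fun s hs => ?_
      simpa [abs_of_nonpos (sub_nonpos.2 hs.2)] using hh s
    refine h1.trans ?_
    rw [abs_of_nonpos (sub_nonpos.2 hx), neg_sub,
      intervalIntegral.integral_comp_sub_left (fun s => B * Real.exp (μ * s)) a, sub_self]
    exact key _ (sub_nonneg.2 hx)

lemma locallyIntegrable_mul_of_bound {Q f : ℝ → ℝ} {M : ℝ} (hQ : Measurable Q)
    (hM : ∀ x, |Q x| ≤ M) (hf : Continuous f) :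
    LocallyIntegrable (fun x => Q x * f x) volume := by
  refine ((continuous_const.mul hf.norm).locallyIntegrable (f := fun x => M * ‖f x‖)).mono
    (hQ.aestronglyMeasurable.mul hf.aestronglyMeasurable) (.of_forall fun x => ?_)
  simp only [norm_mul, Real.norm_eq_abs, abs_abs]
  exact mul_le_mul_of_nonneg_right ((hM x).trans (le_abs_self M)) (abs_nonneg _)

/-- Global solvability of the initial value problem for `f'' = Q f` with `Q` bounded measurable.
In the norm weighted by `exp (-μ |x - a|)` with `μ` large, the Volterra operator for `f'` is a
contraction. -/
lemma exists_solution {Q : ℝ → ℝ} {M : ℝ} (hQ : Measurable Q) (hM : ∀ x, |Q x| ≤ M)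
    (a c₀ c₁ : ℝ) :
    ∃ f f₁ : ℝ → ℝ, IsPrimitive f f₁ ∧ IsPrimitive f₁ (fun x => Q x * f x) ∧
      f a = c₀ ∧ f₁ a = c₁ := by
  have hM0 : 0 ≤ M := (abs_nonneg _).trans (hM 0)
  set μ : ℝ := M + 2 with hμdef
  have hμ : 0 < μ := by positivity
  let w : ℝ → ℝ := fun x => Real.exp (μ * |x - a|)
  have hw : Continuous w := by fun_prop
  have hw1 : ∀ x, 1 ≤ w x := fun x => Real.one_le_exp (by positivity)
  have hwpos : ∀ x, 0 < w x := fun x => Real.exp_pos _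
  let p : (ℝ → ℝ) → ℝ → ℝ := fun z t => c₀ + ∫ s in a..t, w s * z s
  let r : (ℝ → ℝ) → ℝ → ℝ := fun z x => c₁ + ∫ t in a..x, Q t * p z t
  have hp : ∀ z : BoundedContinuousFunction ℝ ℝ, IsPrimitive (p z) (fun s => w s * z s) :=
    fun z => IsPrimitive.integral (hw.mul z.continuous).locallyIntegrable a c₀
  have hr : ∀ z : BoundedContinuousFunction ℝ ℝ, IsPrimitive (r z) (fun t => Q t * p z t) :=
    fun z => IsPrimitive.integral (locallyIntegrable_mul_of_bound hQ hM (hp z).continuous) a c₁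
  have hmul : ∀ (g : ℝ → ℝ) (B : ℝ), (∀ s, |g s| ≤ B * w s) →
      ∀ s, |Q s * g s| ≤ (M * B) * w s := by
    intro g B hg s
    rw [abs_mul, mul_assoc]
    exact mul_le_mul (hM s) (hg s) (abs_nonneg _) hM0
  have hzw : ∀ (z : BoundedContinuousFunction ℝ ℝ) s, |w s * z s| ≤ ‖z‖ * w s := by
    intro z s
    rw [abs_mul, abs_of_pos (hwpos s), mul_comm]
    exact mul_le_mul_of_nonneg_right (z.norm_coe_le_norm s) (hwpos s).le
  have hpb : ∀ (z : BoundedContinuousFunction ℝ ℝ) s, |p z s| ≤ (|c₀| + ‖z‖ / μ) * w s := by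
    intro z s
    have := abs_integral_le_of_abs_le_exp hμ (hzw z) s
    have h2 := le_mul_of_one_le_right (abs_nonneg c₀) (hw1 s)
    calc |p z s| ≤ |c₀| + |∫ t in a..s, w t * z t| := abs_add_le _ _
      _ ≤ |c₀| * w s + ‖z‖ / μ * w s := add_le_add h2 this
      _ = _ := by ring
  have hrb : ∀ (z : BoundedContinuousFunction ℝ ℝ) s,
      |r z s| ≤ (|c₁| + M * (|c₀| + ‖z‖ / μ) / μ) * w s := by
    intro z s
    have := abs_integral_le_of_abs_le_exp hμ (hmul _ _ (hpb z)) s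
    have h2 := le_mul_of_one_le_right (abs_nonneg c₁) (hw1 s)
    calc |r z s| ≤ |c₁| + |∫ t in a..s, Q t * p z t| := abs_add_le _ _
      _ ≤ |c₁| * w s + M * (|c₀| + ‖z‖ / μ) / μ * w s := add_le_add h2 this
      _ = _ := by ring
  let T : BoundedContinuousFunction ℝ ℝ → BoundedContinuousFunction ℝ ℝ := fun z =>
    BoundedContinuousFunction.ofNormedAddCommGroup (fun x => r z x / w x)
      ((hr z).continuous.div hw fun x => (hwpos x).ne') _ (fun x => by
        rw [Real.norm_eq_abs, abs_div, abs_of_pos (hwpos x), div_le_iff₀ (hwpos x)]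
        exact hrb z x)
  have hT : ContractingWith (1 / 2) T := by
    refine ⟨by
      rw [← NNReal.coe_lt_coe]; norm_num, LipschitzWith.of_dist_le_mul fun z y => ?_⟩
    refine (BoundedContinuousFunction.dist_le (by positivity)).2 fun x => ?_
    have e1 : ∀ s, |p z s - p y s| ≤ (‖z - y‖ / μ) * w s := by
      intro s
      have := abs_integral_le_of_abs_le_exp hμ (hzw (z - y)) s
      have e : p z s - p y s = ∫ t in a..s, w t * (z - y) t := by
        simp only [BoundedContinuousFunction.coe_sub, Pi.sub_apply, mul_sub]
        rw [intervalIntegral.integral_sub ((hp z).intervalIntegrable _ _)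
          ((hp y).intervalIntegrable _ _)]
        simp only [p]; ring
      rw [e]; exact this
    have e2 : |r z x - r y x| ≤ (M * (‖z - y‖ / μ) / μ) * w x := by
      have := abs_integral_le_of_abs_le_exp hμ (hmul _ _ e1) x
      have e : r z x - r y x = ∫ t in a..x, Q t * (p z t - p y t) := by
        simp only [mul_sub]
        rw [intervalIntegral.integral_sub ((hr z).intervalIntegrable _ _)
          ((hr y).intervalIntegrable _ _)]
        simp only [r]; ring
      rw [e]; exact this
    have e3 : dist (T z x) (T y x) = |r z x - r y x| / w x := by
      change |r z x / w x - r y x / w x| = _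
      rw [← sub_div, abs_div, abs_of_pos (hwpos x)]
    rw [e3, div_le_iff₀ (hwpos x), dist_eq_norm]
    refine e2.trans (mul_le_mul_of_nonneg_right ?_ (hwpos x).le)
    have : M * (‖z - y‖ / μ) / μ = M / μ ^ 2 * ‖z - y‖ := by field_simp
    rw [this]
    refine mul_le_mul_of_nonneg_right ?_ (norm_nonneg _)
    rw [div_le_iff₀ (by positivity)]
    simp only [NNReal.coe_div, NNReal.coe_one, NNReal.coe_ofNat, hμdef]
    nlinarith
  set z := hT.fixedPoint T with hz
  have hfix : ∀ x, w x * z x = r z x := by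
    intro x
    have : T z = z := hT.fixedPoint_isFixedPt
    have h2 : T z x = r z x / w x := rfl
    rw [this] at h2
    rw [h2, mul_div_cancel₀ _ (hwpos x).ne']
  refine ⟨p z, r z, (hp z).congr hfix, hr z, by simp [p], by simp [r]⟩

/-- Gronwall's inequality for the equation `f'' = Q f + h`. -/
lemma norm_add_norm_le_of_isPrimitive {Q : ℝ → ℝ} {M a b : ℝ} {f f₁ h : ℝ → E} (hab : a ≤ b)
    (hf : IsPrimitive f f₁) (hf₁ : IsPrimitive f₁ (fun x => Q x • f x + h x))
    (hh : LocallyIntegrable h volume) (hM : ∀ x, |Q x| ≤ M) :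
    ‖f b‖ + ‖f₁ b‖ ≤
      (‖f a‖ + ‖f₁ a‖ + ∫ x in a..b, ‖h x‖) * Real.exp ((1 + M) * (b - a)) := by
  have hM0 : 0 ≤ M := (abs_nonneg _).trans (hM 0)
  set s : ℝ → ℝ := fun x => ‖f x‖ + ‖f₁ x‖ with hs
  have hsc : Continuous s := hf.continuous.norm.add hf₁.continuous.norm
  have hs0 : ∀ x, 0 ≤ s x := fun x => by positivity
  have hhn : ∀ x y, IntervalIntegrable (fun x => ‖h x‖) volume x y := fun x y =>
    (hh.intervalIntegrable' x y).norm
  set c := s a + ∫ x in a..b, ‖h x‖ with hc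
  have hc0 : 0 ≤ c := add_nonneg (hs0 a)
    (intervalIntegral.integral_nonneg hab fun x _ => norm_nonneg _)
  set J : ℝ → ℝ := fun x => c + ∫ t in a..x, (1 + M) * s t with hJ
  have hJd : ∀ x, HasDerivAt J ((1 + M) * s x) x := fun x =>
    (((continuous_const.mul hsc).integral_hasStrictDerivAt a x).hasDerivAt).const_add _
  have hsi : ∀ x y, IntervalIntegrable (fun t => (1 + M) * s t) volume x y := fun x y =>
    (continuous_const.mul hsc).intervalIntegrable _ _
  have hle : ∀ x ∈ Set.Icc a b, s x ≤ J x := by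
    intro x hx
    have h1 : ‖f x‖ ≤ ‖f a‖ + ∫ t in a..x, ‖f₁ t‖ := by
      have := hf.norm_sub_le hx.1
      have h3 := norm_le_norm_add_norm_sub' (f x) (f a)
      linarith
    have h2 : ‖f₁ x‖ ≤ ‖f₁ a‖ + ∫ t in a..x, ‖Q t • f t + h t‖ := by
      have := hf₁.norm_sub_le hx.1
      have h3 := norm_le_norm_add_norm_sub' (f₁ x) (f₁ a)
      linarith
    have h4 : (∫ t in a..x, ‖f₁ t‖) + ∫ t in a..x, ‖Q t • f t + h t‖ ≤
        ∫ t in a..x, ((1 + M) * s t + ‖h t‖) := by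
      rw [← intervalIntegral.integral_add (hf.intervalIntegrable _ _).norm
        (hf₁.intervalIntegrable _ _).norm]
      refine intervalIntegral.integral_mono_on hx.1
        ((hf.intervalIntegrable _ _).norm.add (hf₁.intervalIntegrable _ _).norm)
        ((hsi _ _).add (hhn _ _)) fun t _ => ?_
      have h5 : ‖Q t • f t + h t‖ ≤ M * ‖f t‖ + ‖h t‖ := by
        refine (norm_add_le _ _).trans ?_
        rw [norm_smul]
        gcongr
        exact hM t
      simp only [hs]
      nlinarith [norm_nonneg (f t), norm_nonneg (f₁ t), mul_nonneg hM0 (norm_nonneg (f₁ t))]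
    rw [intervalIntegral.integral_add (hsi _ _) (hhn _ _)] at h4
    have h6 : ∫ t in a..x, ‖h t‖ ≤ ∫ t in a..b, ‖h t‖ :=
      intervalIntegral.integral_mono_interval le_rfl hx.1 hx.2
        (.of_forall fun t => norm_nonneg _) (hhn _ _)
    simp only [hJ, hc, hs] at *
    linarith
  have hJ0 : ∀ x ∈ Set.Icc a b, 0 ≤ J x := fun x hx => (hs0 x).trans (hle x hx)
  have key := norm_le_gronwallBound_of_norm_deriv_right_le (f := J)
    (f' := fun x => (1 + M) * s x) (δ := c) (K := 1 + M) (ε := 0) (a := a) (b := b)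
    (continuous_iff_continuousAt.2 fun x => (hJd x).continuousAt).continuousOn
    (fun x _ => (hJd x).hasDerivWithinAt) (by simp [hJ, abs_of_nonneg hc0])
    (fun x hx => by
      have h1 := hle x ⟨hx.1, hx.2.le⟩
      rw [Real.norm_of_nonneg (mul_nonneg (by positivity) (hs0 x)),
        Real.norm_of_nonneg (hJ0 x ⟨hx.1, hx.2.le⟩), add_zero]
      gcongr) b ⟨hab, le_rfl⟩
  rw [gronwallBound_ε0, Real.norm_of_nonneg (hJ0 b ⟨hab, le_rfl⟩)] at key
  exact (hle b ⟨hab, le_rfl⟩).trans key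

/-! ### Solutions outside the support of the potential -/

/-- A measurable potential which is bounded by `M` and vanishes for `|x| > R`, both at every point.
Every `IsPotential` agrees almost everywhere with one of these. -/
structure IsBoundedPotential (q : ℝ → ℝ) (M R : ℝ) : Prop where
  measurable : Measurable q
  abs_le : ∀ x, |q x| ≤ M
  eq_zero : ∀ x, R < |x| → q x = 0
  pos : 0 < R

namespace IsBoundedPotential

variable {q : ℝ → ℝ} {M R : ℝ}

lemma nonneg (hq : IsBoundedPotential q M R) : 0 ≤ M := (abs_nonneg _).trans (hq.abs_le 0)

lemma comp_neg (hq : IsBoundedPotential q M R) : IsBoundedPotential (fun x => q (-x)) M R :=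
  ⟨hq.measurable.comp measurable_neg, fun x => hq.abs_le _,
    fun x hx => hq.eq_zero _ (by rwa [abs_neg]), hq.pos⟩

lemma abs_add_sq_le (hq : IsBoundedPotential q M R) (k x : ℝ) : |q x + k ^ 2| ≤ M + k ^ 2 := by
  refine (abs_add_le _ _).trans ?_
  rw [abs_of_nonneg (sq_nonneg k)]
  linarith [hq.abs_le x]

end IsBoundedPotential

lemma IsPotential.exists_isBoundedPotential {q : ℝ → ℝ} (hq : IsPotential q) :
    ∃ (p : ℝ → ℝ) (M R : ℝ), q =ᵐ[volume] p ∧ IsBoundedPotential p M R := by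
  obtain ⟨hm, R, hR⟩ := hq
  set M := (eLpNorm q ⊤ volume).toReal
  have hM : ∀ᵐ x, |q x| ≤ M := by
    have h1 := ae_le_eLpNormEssSup (f := q) (μ := volume)
    filter_upwards [h1] with x hx
    rw [← eLpNorm_exponent_top] at hx
    have := ENNReal.toReal_mono hm.2.ne hx
    simpa [M] using this
  obtain ⟨q', hq'm, hq'⟩ := hm.1.aemeasurable
  refine ⟨fun x => if |q' x| ≤ M ∧ |x| ≤ max R 1 then q' x else 0, M, max R 1, ?_, ?_, ?_, ?_, ?_⟩
  · filter_upwards [hM, hR, hq'] with x h1 h2 h3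
    rw [← h3]
    split_ifs with h
    · rfl
    · have : R < |x| := by
        by_contra h'
        exact h ⟨h1, (not_lt.1 h').trans (le_max_left _ _)⟩
      exact h2 this
  · refine Measurable.ite ?_ hq'm measurable_const
    exact (measurableSet_le hq'm.abs measurable_const).inter
      (measurableSet_le measurable_id.abs measurable_const)
  · intro x
    split_ifs with h
    · exact h.1
    · simp [M]
  · intro x hx
    exact if_neg fun h => absurd h.2 (not_le.2 hx)
  · positivity

section Amplitudes

variable [CompleteSpace E] {q : ℝ → ℝ} {M R κ : ℝ} {f f₁ : ℝ → E}

/-- Variation of constants: the amplitude of `exp (κ x)` in a solution varies only on the support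
of `q`. -/
lemma isPrimitive_exp_smul (hf : IsPrimitive f f₁)
    (hf₁ : IsPrimitive f₁ (fun x => (q x + κ ^ 2) • f x)) :
    IsPrimitive (fun x => Real.exp (-κ * x) • (f₁ x + κ • f x))
      (fun x => Real.exp (-κ * x) • (q x • f x)) := by
  have he : IsPrimitive (fun x => Real.exp (-κ * x)) (fun x => Real.exp (-κ * x) * -κ) := by
    refine IsPrimitive.of_hasDerivAt (fun x => ?_) (by fun_prop)
    simpa using ((hasDerivAt_id x).const_mul (-κ)).exp
  refine (he.smul (hf₁.add (hf.const_smul κ))).congr fun x => ?_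
  module

/-- To the right of the support of `q`, the component of a solution along `exp (κ x)` is a pure
exponential. -/
lemma amplitude_right (hq : IsBoundedPotential q M R) (hf : IsPrimitive f f₁)
    (hf₁ : IsPrimitive f₁ (fun x => (q x + κ ^ 2) • f x)) {x : ℝ} (hx : R ≤ x) :
    f₁ x + κ • f x = Real.exp (κ * (x - R)) • (f₁ R + κ • f R) := by
  have := (isPrimitive_exp_smul hf hf₁).eq_of_ae_eq_zero hx (.of_forall fun t ht => by
    rw [hq.eq_zero t (ht.1.trans_le (le_abs_self t)), zero_smul, smul_zero])
  rw [show κ * (x - R) = κ * x + -κ * R by ring, Real.exp_add, mul_smul, this, smul_smul,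
    ← Real.exp_add]
  simp

lemma amplitude_left (hq : IsBoundedPotential q M R) (hf : IsPrimitive f f₁)
    (hf₁ : IsPrimitive f₁ (fun x => (q x + κ ^ 2) • f x)) {x : ℝ} (hx : x ≤ -R) :
    f₁ x + κ • f x = Real.exp (κ * (x + R)) • (f₁ (-R) + κ • f (-R)) := by
  have := (isPrimitive_exp_smul hf hf₁).eq_of_ae_eq_zero hx (by
    filter_upwards [Measure.ae_ne volume (-R)] with t htR ht
    have : t < -R := lt_of_le_of_ne ht.2 htR
    rw [hq.eq_zero t (by rw [lt_abs]; right; linarith), zero_smul, smul_zero])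
  rw [show κ * (x + R) = κ * x + -κ * (-R) by ring, Real.exp_add, mul_smul, ← this, smul_smul,
    ← Real.exp_add]
  simp

end Amplitudes

/-- A lower bound on a set of infinite measure for the norm of an `L²` function is trivial. -/
lemma eq_zero_of_memLp_of_norm_le {E : Type*} [NormedAddCommGroup E] {w : ℝ → E}
    {c : E} {s : Set ℝ} (hs : MeasurableSet s)
    (hv : volume s = ⊤) (hw : MemLp w 2 volume) (h : ∀ x ∈ s, ‖c‖ ≤ ‖w x‖) : c = 0 := by
  have h1 : MemLp (fun _ : ℝ => c) 2 (volume.restrict s) :=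
    (hw.restrict s).mono aestronglyMeasurable_const (by
      filter_upwards [ae_restrict_mem hs] with x hx using h x hx)
  rw [memLp_const_iff (by norm_num) (by norm_num)] at h1
  rcases h1 with h1 | h1
  · exact h1
  · simp [hv] at h1

lemma isPrimitive_reflect {Q : ℝ → ℝ} {f f₁ : ℝ → E} (hf : IsPrimitive f f₁)
    (hf₁ : IsPrimitive f₁ (fun x => Q x • f x)) :
    IsPrimitive (fun x => f (-x)) (fun x => -f₁ (-x)) ∧
      IsPrimitive (fun x => -f₁ (-x)) (fun x => Q (-x) • f (-x)) :=
  ⟨hf.comp_neg, hf₁.comp_neg.neg.congr fun _ => neg_neg _⟩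

section Boundary

variable [CompleteSpace E] {q : ℝ → ℝ} {M R k : ℝ} {f f₁ : ℝ → E}

/-- A square integrable solution has no growing component to the right of the support. -/
lemma right_condition_of_memLp (hq : IsBoundedPotential q M R) (hk : 0 < k)
    (hf : IsPrimitive f f₁) (hf₁ : IsPrimitive f₁ (fun x => (q x + k ^ 2) • f x))
    (h : MemLp f 2 volume) (h₁ : MemLp f₁ 2 volume) : f₁ R + k • f R = 0 := by
  refine eq_zero_of_memLp_of_norm_le (w := fun x => f₁ x + k • f x) (measurableSet_Ioi (a := R))
    Real.volume_Ioi (h₁.add (h.const_smul k)) fun x hx => ?_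
  rw [amplitude_right hq hf hf₁ (le_of_lt hx), norm_smul, Real.norm_of_nonneg (Real.exp_pos _).le]
  exact le_mul_of_one_le_left (norm_nonneg _)
    (Real.one_le_exp (mul_nonneg hk.le (sub_nonneg.2 (le_of_lt hx))))

lemma left_condition_of_memLp (hq : IsBoundedPotential q M R) (hk : 0 < k)
    (hf : IsPrimitive f f₁) (hf₁ : IsPrimitive f₁ (fun x => (q x + k ^ 2) • f x))
    (h : MemLp f 2 volume) (h₁ : MemLp f₁ 2 volume) : f₁ (-R) = k • f (-R) := by
  have hf₁' : IsPrimitive f₁ (fun x => (q x + (-k) ^ 2) • f x) := by simpa using hf₁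
  have := eq_zero_of_memLp_of_norm_le (w := fun x => f₁ x + (-k) • f x)
    (c := f₁ (-R) + (-k) • f (-R)) (measurableSet_Iio (a := -R))
    Real.volume_Iio (h₁.add (h.const_smul (-k))) fun x hx => by
      rw [amplitude_left hq hf hf₁' (le_of_lt hx), norm_smul,
        Real.norm_of_nonneg (Real.exp_pos _).le]
      refine le_mul_of_one_le_left (norm_nonneg _) (Real.one_le_exp ?_)
      have : x < -R := hx
      nlinarith
  rwa [neg_smul, ← sub_eq_add_neg, sub_eq_zero] at this

lemma eq_exp_smul_of_left_condition (hq : IsBoundedPotential q M R) (hk : 0 < k)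
    (hf : IsPrimitive f f₁) (hf₁ : IsPrimitive f₁ (fun x => (q x + k ^ 2) • f x))
    (hl : f₁ (-R) = k • f (-R)) {x : ℝ} (hx : x ≤ -R) :
    f x = Real.exp (k * (x + R)) • f (-R) ∧ f₁ x = k • f x := by
  have hf₁' : IsPrimitive f₁ (fun x => (q x + (-k) ^ 2) • f x) := by simpa using hf₁
  have h1 := amplitude_left hq hf hf₁ hx
  have h2 := amplitude_left hq hf hf₁' hx
  rw [hl, neg_smul, neg_smul, add_neg_cancel, smul_zero, ← sub_eq_add_neg, sub_eq_zero] at h2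
  refine ⟨?_, h2⟩
  rw [hl, h2] at h1
  refine smul_right_injective E (by positivity : (2 : ℝ) * k ≠ 0) ?_
  calc (2 * k) • f x = k • f x + k • f x := by module
    _ = (2 * k) • Real.exp (k * (x + R)) • f (-R) := by rw [h1]; module

/-- A solution without growing component at `-∞` is bounded by `exp (k x)` on the whole line, since
to the right of the support it can at most grow at that rate. -/
lemma exists_exp_bound_of_left_condition (hq : IsBoundedPotential q M R) (hk : 0 < k)
    (hf : IsPrimitive f f₁) (hf₁ : IsPrimitive f₁ (fun x => (q x + k ^ 2) • f x))
    (hl : f₁ (-R) = k • f (-R)) :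
    ∃ C : ℝ, ∀ x, ‖f x‖ + ‖f₁ x‖ ≤ C * Real.exp (k * x) := by
  have hf₁' : IsPrimitive f₁ (fun x => (q x + (-k) ^ 2) • f x) := by simpa using hf₁
  set F : ℝ → ℝ := fun x => (‖f x‖ + ‖f₁ x‖) * Real.exp (-(k * x)) with hF
  have hFc : Continuous F := by
    have := hf.continuous
    have := hf₁.continuous
    fun_prop
  obtain ⟨C₁, hC₁⟩ := (isCompact_Icc (a := -R) (b := R)).exists_bound_of_continuousOn
    hFc.continuousOn
  set A := ‖f₁ R + k • f R‖
  set B := ‖f₁ R + (-k) • f R‖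
  set C₂ := (1 + 1 / k) * (A + B) * Real.exp (-(k * R))
  set C₃ := (1 + k) * ‖f (-R)‖ * Real.exp (k * R)
  have hA : 0 ≤ A := norm_nonneg _
  have hB : 0 ≤ B := norm_nonneg _
  have h2 : 0 ≤ C₂ := by positivity
  have h3 : 0 ≤ C₃ := by positivity
  refine ⟨max C₁ 0 + C₂ + C₃, fun x => ?_⟩
  have hmax := le_max_left C₁ 0
  have hmax0 := le_max_right C₁ 0
  suffices h : F x ≤ max C₁ 0 + C₂ + C₃ by
    have := mul_le_mul_of_nonneg_right h (Real.exp_pos (k * x)).le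
    rwa [hF, mul_assoc, ← Real.exp_add, neg_add_cancel, Real.exp_zero, mul_one] at this
  rcases le_total x (-R) with hx | hx
  · obtain ⟨e1, e2⟩ := eq_exp_smul_of_left_condition hq hk hf hf₁ hl hx
    have : F x = C₃ := by
      simp only [hF, C₃]
      rw [e2, norm_smul, e1, norm_smul, Real.norm_of_nonneg hk.le,
        Real.norm_of_nonneg (Real.exp_pos _).le, mul_add, Real.exp_add, Real.exp_neg]
      field_simp
    linarith
  rcases le_total x R with hx' | hx'
  · have := hC₁ x ⟨hx, hx'⟩
    have := (le_abs_self _).trans this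
    linarith
  · have a1 := amplitude_right hq hf hf₁ hx'
    have a2 := amplitude_right hq hf hf₁' hx'
    have n1 : ‖f₁ x + k • f x‖ ≤ Real.exp (k * (x - R)) * A := by
      rw [a1, norm_smul, Real.norm_of_nonneg (Real.exp_pos _).le]
    have n2 : ‖f₁ x + (-k) • f x‖ ≤ Real.exp (k * (x - R)) * B := by
      rw [a2, norm_smul, Real.norm_of_nonneg (Real.exp_pos _).le]
      refine mul_le_mul_of_nonneg_right (Real.exp_le_exp.2 ?_) hB
      nlinarith
    have m1 : ‖f₁ x‖ ≤ Real.exp (k * (x - R)) * (A + B) := by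
      have : f₁ x = (1 / 2 : ℝ) • ((f₁ x + k • f x) + (f₁ x + (-k) • f x)) := by module
      rw [this, norm_smul, Real.norm_of_nonneg (by norm_num)]
      have := norm_add_le (f₁ x + k • f x) (f₁ x + (-k) • f x)
      have := norm_nonneg (f₁ x + k • f x + (f₁ x + (-k) • f x))
      linarith
    have m2 : k * ‖f x‖ ≤ Real.exp (k * (x - R)) * (A + B) := by
      have : k • f x = (1 / 2 : ℝ) • ((f₁ x + k • f x) - (f₁ x + (-k) • f x)) := by module
      rw [← Real.norm_of_nonneg hk.le, ← norm_smul, Real.norm_of_nonneg hk.le, this, norm_smul,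
        Real.norm_of_nonneg (by norm_num)]
      have := norm_sub_le (f₁ x + k • f x) (f₁ x + (-k) • f x)
      have := norm_nonneg (f₁ x + k • f x - (f₁ x + (-k) • f x))
      linarith
    have m3 : ‖f x‖ ≤ 1 / k * (Real.exp (k * (x - R)) * (A + B)) := by
      rw [one_div, ← div_eq_inv_mul, le_div_iff₀ hk]; linarith
    have : F x ≤ C₂ := by
      have e : C₂ = ((1 + 1 / k) * (Real.exp (k * (x - R)) * (A + B))) * Real.exp (-(k * x)) := by
        simp only [C₂]
        rw [show k * (x - R) = -(k * R) + k * x by ring, Real.exp_add, Real.exp_neg (k * x)]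
        field_simp
      rw [e]
      refine mul_le_mul_of_nonneg_right ?_ (Real.exp_pos _).le
      linarith
    linarith

lemma exists_exp_bound_of_right_condition (hq : IsBoundedPotential q M R) (hk : 0 < k)
    (hf : IsPrimitive f f₁) (hf₁ : IsPrimitive f₁ (fun x => (q x + k ^ 2) • f x))
    (hr : f₁ R + k • f R = 0) :
    ∃ C : ℝ, ∀ x, ‖f x‖ + ‖f₁ x‖ ≤ C * Real.exp (-(k * x)) := by
  obtain ⟨h1, h2⟩ := isPrimitive_reflect hf hf₁
  obtain ⟨C, hC⟩ := exists_exp_bound_of_left_condition hq.comp_neg hk h1 h2 (by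
    rw [neg_neg]; exact neg_eq_of_add_eq_zero_right hr)
  refine ⟨C, fun x => ?_⟩
  simpa using hC (-x)

end Boundary

lemma eq_zero_of_initial_eq_zero {Q : ℝ → ℝ} {M a b : ℝ} {f f₁ : ℝ → E} (hab : a ≤ b)
    (hf : IsPrimitive f f₁) (hf₁ : IsPrimitive f₁ (fun x => Q x • f x)) (hM : ∀ x, |Q x| ≤ M)
    (h0 : f a = 0) (h1 : f₁ a = 0) : f b = 0 ∧ f₁ b = 0 := by
  have := norm_add_norm_le_of_isPrimitive (h := fun _ => 0) hab hf (hf₁.congr fun x => by simp)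
    locallyIntegrable_zero hM
  simp only [h0, h1, norm_zero, intervalIntegral.integral_zero, add_zero, zero_mul] at this
  constructor
  · rw [← norm_le_zero_iff]; linarith [norm_nonneg (f₁ b)]
  · rw [← norm_le_zero_iff]; linarith [norm_nonneg (f b)]

/-- `φ` is the solution of `-φ'' + q φ = -k² φ`, with derivative `φ₁`, which equals
`exp (k (x + R))` to the left of the support of `q`: the left Jost solution up to normalization. -/
structure IsLeftJost (q : ℝ → ℝ) (R k : ℝ) (φ φ₁ : ℝ → ℝ) : Prop where
  deriv : IsPrimitive φ φ₁
  deriv₁ : IsPrimitive φ₁ (fun x => (q x + k ^ 2) * φ x)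
  left : φ (-R) = 1
  left₁ : φ₁ (-R) = k

lemma IsBoundedPotential.exists_isLeftJost {q : ℝ → ℝ} {M R : ℝ} (hq : IsBoundedPotential q M R)
    (k : ℝ) : ∃ φ φ₁, IsLeftJost q R k φ φ₁ := by
  obtain ⟨φ, φ₁, h1, h2, h3, h4⟩ := exists_solution (Q := fun x => q x + k ^ 2)
    (hq.measurable.add_const _) (hq.abs_add_sq_le k) (-R) 1 k
  exact ⟨φ, φ₁, h1, h2, h3, h4⟩

/-! ### The eigenvalue condition -/

lemma SchrodingerGraph.exists_isPrimitive {q : ℝ → ℝ} {ψ f : ℝ → ℂ}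
    (h : SchrodingerGraph q ψ f) :
    ∃ F F₁ : ℝ → ℂ, ψ =ᵐ[volume] F ∧ IsPrimitive F F₁ ∧
      IsPrimitive F₁ (fun x => q x • F x - f x) ∧ MemLp F 2 volume ∧ MemLp F₁ 2 volume := by
  obtain ⟨ψ₁, ψ₂, m, m₁, m₂, w, w₁, mf, hae⟩ := h
  obtain ⟨F, hF, hFp⟩ := w.exists_isPrimitive
  obtain ⟨F₁, hF₁, hFp₁⟩ := w₁.exists_isPrimitive
  refine ⟨F, F₁, hF, hFp.congr_ae hF₁, hFp₁.congr_ae ?_, m.ae_eq hF, m₁.ae_eq hF₁⟩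
  filter_upwards [hae, hF] with x hx hx'
  rw [hx, hx', Complex.real_smul]
  ring

lemma schrodingerGraph_of_isPrimitive {q : ℝ → ℝ} {M R : ℝ} (hq : IsBoundedPotential q M R)
    {F F₁ f : ℝ → ℂ} (hF : IsPrimitive F F₁) (hF₁ : IsPrimitive F₁ (fun x => q x • F x - f x))
    (m : MemLp F 2 volume) (m₁ : MemLp F₁ 2 volume) (mf : MemLp f 2 volume) :
    SchrodingerGraph q F f := by
  refine ⟨F₁, fun x => q x • F x - f x, m, m₁, ?_, hF.hasWeakDeriv, hF₁.hasWeakDeriv, mf,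
    .of_forall fun x => ?_⟩
  · refine MemLp.sub ?_ mf
    refine MemLp.of_le_mul (c := M) m
      (hq.measurable.aestronglyMeasurable.smul m.1) (.of_forall fun x => ?_)
    rw [norm_smul]
    exact mul_le_mul_of_nonneg_right (hq.abs_le x) (norm_nonneg _)
  · simp only [Complex.real_smul]; ring

lemma SchrodingerGraph.congr_ae {q q' : ℝ → ℝ} (h : q =ᵐ[volume] q') {ψ ψ' f f' : ℝ → ℂ}
    (hψ : ψ =ᵐ[volume] ψ') (hf : f =ᵐ[volume] f') (hg : SchrodingerGraph q ψ f) :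
    SchrodingerGraph q' ψ' f' := by
  obtain ⟨ψ₁, ψ₂, m, m₁, m₂, w, w₁, mf, hae⟩ := hg
  refine ⟨ψ₁, ψ₂, m.ae_eq hψ, m₁, m₂, ⟨w.1.congr hψ, w.2.1, fun φ h1 h2 => ?_⟩, w₁,
    mf.ae_eq hf, ?_⟩
  · rw [← w.2.2 φ h1 h2]
    exact integral_congr_ae (by filter_upwards [hψ] with x hx using by rw [hx])
  · filter_upwards [hae, h, hψ, hf] with x h1 h2 h3 h4
    rw [← h4, ← h2, ← h3, h1]

lemma IsEigenvalue.congr_ae {q q' : ℝ → ℝ} (h : q =ᵐ[volume] q') {e : ℝ}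
    (he : IsEigenvalue q e) : IsEigenvalue q' e := by
  obtain ⟨ψ, h0, hψ⟩ := he
  exact ⟨ψ, h0, hψ.congr_ae h (EventuallyEq.refl _ _) (EventuallyEq.refl _ _)⟩

lemma InResolventSet.congr_ae {q q' : ℝ → ℝ} (h : q =ᵐ[volume] q') {z : ℝ}
    (hz : InResolventSet q z) : InResolventSet q' z := by
  obtain ⟨h1, C, h2⟩ := hz
  refine ⟨fun g hg => ?_, C, fun ψ f hψ => h2 ψ f ?_⟩
  · obtain ⟨ψ, hψ⟩ := h1 g hg
    exact ⟨ψ, hψ.congr_ae h (EventuallyEq.refl _ _) (EventuallyEq.refl _ _)⟩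
  · exact hψ.congr_ae h.symm (EventuallyEq.refl _ _) (EventuallyEq.refl _ _)

lemma integrable_exp_neg_mul_abs {k : ℝ} (hk : 0 < k) :
    Integrable (fun x : ℝ => Real.exp (-(k * |x|))) := by
  rw [← integrableOn_univ, ← Set.Iic_union_Ioi (a := (0 : ℝ))]
  refine IntegrableOn.union ?_ ?_
  · refine (integrableOn_exp_mul_Iic hk 0).congr_fun (fun x hx => ?_) measurableSet_Iic
    simp only [abs_of_nonpos (Set.mem_Iic.1 hx), mul_neg, neg_neg]
  · refine (integrableOn_exp_mul_Ioi (neg_lt_zero.2 hk) 0).congr_fun (fun x hx => ?_)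
      measurableSet_Ioi
    simp only [abs_of_pos (Set.mem_Ioi.1 hx), neg_mul]

lemma memLp_exp_neg_mul_abs {k : ℝ} (hk : 0 < k) :
    MemLp (fun x : ℝ => Real.exp (-(k * |x|))) 2 volume := by
  rw [memLp_two_iff_integrable_sq (by fun_prop)]
  refine (integrable_exp_neg_mul_abs (k := 2 * k) (by positivity)).congr (.of_forall fun x => ?_)
  simp only [← Real.exp_nat_mul]
  congr 1; push_cast; ring

lemma memLp_of_exp_bounds {E : Type*} [NormedAddCommGroup E] {f : ℝ → E} {k C C' : ℝ}
    (hk : 0 < k) (hf : Continuous f)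
    (h : ∀ x, ‖f x‖ ≤ C * Real.exp (k * x)) (h' : ∀ x, ‖f x‖ ≤ C' * Real.exp (-(k * x))) :
    MemLp f 2 volume := by
  refine MemLp.of_le_mul (c := max C C') (memLp_exp_neg_mul_abs hk)
    hf.aestronglyMeasurable (.of_forall fun x => ?_)
  rw [Real.norm_of_nonneg (Real.exp_pos _).le]
  rcases le_total 0 x with hx | hx
  · rw [abs_of_nonneg hx]
    exact (h' x).trans (mul_le_mul_of_nonneg_right (le_max_right _ _) (Real.exp_pos _).le)
  · rw [abs_of_nonpos hx, mul_neg, neg_neg]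
    exact (h x).trans (mul_le_mul_of_nonneg_right (le_max_left _ _) (Real.exp_pos _).le)

/-- The number `-k²` is an eigenvalue iff the left Jost solution decays on the right as well. -/
lemma isEigenvalue_iff {q : ℝ → ℝ} {M R k : ℝ} (hq : IsBoundedPotential q M R) (hk : 0 < k)
    {φ φ₁ : ℝ → ℝ} (hφ : IsLeftJost q R k φ φ₁) :
    IsEigenvalue q (-k ^ 2) ↔ φ₁ R + k * φ R = 0 := by
  constructor
  · rintro ⟨ψ, hψ0, hψ⟩
    obtain ⟨F, F₁, hψF, hF, hF₁, m, m₁⟩ := hψ.exists_isPrimitive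
    have hF₁' : IsPrimitive F₁ (fun x => (q x + k ^ 2) • F x) := hF₁.congr_ae (by
      filter_upwards [hψF] with x hx
      simp only [hx, Complex.real_smul]
      push_cast; ring)
    have hr := right_condition_of_memLp hq hk hF hF₁' m m₁
    have hl := left_condition_of_memLp hq hk hF hF₁' m m₁
    set c := F (-R)
    have hRR : -R ≤ R := by linarith [hq.pos]
    have hb := hq.abs_add_sq_le k
    -- by uniqueness for the initial value problem, the eigenfunction is a multiple of `φ`
    have d1 : IsPrimitive (fun x => F x - φ x • c) (fun x => F₁ x - φ₁ x • c) :=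
      (hF.sub (hφ.deriv.smul (IsPrimitive.const c))).congr fun x => by simp
    have d2 : IsPrimitive (fun x => F₁ x - φ₁ x • c)
        (fun x => (q x + k ^ 2) • (F x - φ x • c)) :=
      (hF₁'.sub (hφ.deriv₁.smul (IsPrimitive.const c))).congr fun x => by module
    obtain ⟨e1, e2⟩ := eq_zero_of_initial_eq_zero hRR d1 d2 hb (by simp [hφ.left, c])
      (by simp [hφ.left₁, hl, c])
    rw [sub_eq_zero] at e1 e2
    rw [e1, e2, smul_smul, ← add_smul, smul_eq_zero] at hr
    rcases hr with hr | hr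
    · exact hr
    · exfalso
      refine hψ0 (hψF.trans (.of_forall fun x => ?_))
      rcases le_total x (-R) with hx | hx
      · rw [(eq_exp_smul_of_left_condition hq hk hF hF₁' hl hx).1]
        simp [c, hr]
      · exact (eq_zero_of_initial_eq_zero hx hF hF₁' hb hr (by rw [hl]; simp [c, hr])).1
  · intro h0
    obtain ⟨C, hC⟩ := exists_exp_bound_of_left_condition hq hk hφ.deriv hφ.deriv₁
      (by simp [hφ.left, hφ.left₁])
    obtain ⟨C', hC'⟩ := exists_exp_bound_of_right_condition hq hk hφ.deriv hφ.deriv₁ h0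
    have m : MemLp φ 2 volume := memLp_of_exp_bounds hk hφ.deriv.continuous
      (fun x => (le_add_of_nonneg_right (norm_nonneg _)).trans (hC x))
      (fun x => (le_add_of_nonneg_right (norm_nonneg _)).trans (hC' x))
    have m₁ : MemLp φ₁ 2 volume := memLp_of_exp_bounds hk hφ.deriv₁.continuous
      (fun x => (le_add_of_nonneg_left (norm_nonneg _)).trans (hC x))
      (fun x => (le_add_of_nonneg_left (norm_nonneg _)).trans (hC' x))
    have h1 := hφ.deriv.clm_comp Complex.ofRealCLM
    have h2 := hφ.deriv₁.clm_comp Complex.ofRealCLM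
    simp only [Complex.ofRealCLM_apply] at h1 h2
    refine ⟨fun x => (φ x : ℂ), fun hz => ?_, schrodingerGraph_of_isPrimitive hq h1
      (h2.congr fun x => ?_) m.ofReal m₁.ofReal (m.ofReal.const_mul _)⟩
    · have : (fun x => (φ x : ℂ)) = fun _ => 0 :=
        (Continuous.ae_eq_iff_eq volume h1.continuous continuous_const).1 hz
      have := congrFun this (-R)
      simp [hφ.left] at this
    · rw [Complex.real_smul]; push_cast; ring

/-! ### The resolvent set -/

open scoped ENNReal in
/-- The Schur test for convolution kernels, on `L²`. -/
lemma lintegral_sq_convolution_le {e G : ℝ → ℝ≥0∞} (he : Measurable e) (hG : AEMeasurable G) :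
    ∫⁻ x, (∫⁻ y, e (x - y) * G y) ^ (2 : ℝ) ≤ (∫⁻ x, e x) ^ (2 : ℝ) * ∫⁻ y, G y ^ (2 : ℝ) := by
  have hsub : ∀ x, ∫⁻ y, e (x - y) = ∫⁻ y, e y := fun x =>
    lintegral_sub_left_eq_self (μ := volume) e x
  have hsub' : ∀ y, ∫⁻ x, e (x - y) = ∫⁻ x, e x := fun y =>
    lintegral_sub_right_eq_self (μ := volume) e y
  have cs : ∀ x, (∫⁻ y, e (x - y) * G y) ^ (2 : ℝ) ≤
      (∫⁻ y, e y) * ∫⁻ y, e (x - y) * G y ^ (2 : ℝ) := by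
    intro x
    have hm : AEMeasurable fun y => e (x - y) :=
      (he.comp (measurable_const.sub measurable_id)).aemeasurable
    have h := ENNReal.lintegral_mul_le_Lp_mul_Lq volume Real.HolderConjugate.two_two
      (f := fun y => e (x - y) ^ (1 / 2 : ℝ)) (g := fun y => e (x - y) ^ (1 / 2 : ℝ) * G y)
      (hm.pow_const _) ((hm.pow_const _).mul hG)
    have e1 : ∀ y, e (x - y) ^ (1 / 2 : ℝ) * (e (x - y) ^ (1 / 2 : ℝ) * G y) =
        e (x - y) * G y := by
      intro y
      rw [← mul_assoc, ← ENNReal.rpow_add_of_nonneg _ _ (by norm_num) (by norm_num)]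
      norm_num
    have e2 : ∀ y, (e (x - y) ^ (1 / 2 : ℝ)) ^ (2 : ℝ) = e (x - y) := by
      intro y
      rw [← ENNReal.rpow_mul]; norm_num
    simp only [Pi.mul_apply, e1, e2, ENNReal.mul_rpow_of_nonneg _ _ (zero_le_two (α := ℝ)), hsub]
      at h
    have h2 := ENNReal.rpow_le_rpow h (zero_le_two (α := ℝ))
    rwa [ENNReal.mul_rpow_of_nonneg _ _ (zero_le_two (α := ℝ)), ← ENNReal.rpow_mul,
      ← ENNReal.rpow_mul, one_div, inv_mul_cancel₀ two_ne_zero, ENNReal.rpow_one,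
      ENNReal.rpow_one] at h2
  have hG2 : AEMeasurable fun y => G y ^ (2 : ℝ) := hG.pow_const _
  calc ∫⁻ x, (∫⁻ y, e (x - y) * G y) ^ (2 : ℝ)
      ≤ ∫⁻ x, (∫⁻ y, e y) * ∫⁻ y, e (x - y) * G y ^ (2 : ℝ) := lintegral_mono cs
    _ = (∫⁻ y, e y) * ∫⁻ x, ∫⁻ y, e (x - y) * G y ^ (2 : ℝ) := by
        refine lintegral_const_mul'' _ ?_
        refine AEMeasurable.lintegral_prod_right'
          (f := fun p : ℝ × ℝ => e (p.1 - p.2) * G p.2 ^ (2 : ℝ)) ?_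
        exact (he.comp (measurable_fst.sub measurable_snd)).aemeasurable.mul
          (hG2.comp_quasiMeasurePreserving Measure.quasiMeasurePreserving_snd)
    _ = (∫⁻ y, e y) * ∫⁻ y, ∫⁻ x, e (x - y) * G y ^ (2 : ℝ) := by
        rw [lintegral_lintegral_swap]
        exact (he.comp (measurable_fst.sub measurable_snd)).aemeasurable.mul
          (hG2.comp_quasiMeasurePreserving Measure.quasiMeasurePreserving_snd)
    _ = (∫⁻ y, e y) * ∫⁻ y, (∫⁻ x, e x) * G y ^ (2 : ℝ) := by
        congr 1
        refine lintegral_congr fun y => ?_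
        rw [lintegral_mul_const _ (f := fun x => e (x - y))
          (he.comp (measurable_id.sub measurable_const)), hsub' y]
    _ = _ := by
        rw [lintegral_const_mul'' _ hG2, ← mul_assoc, ENNReal.rpow_two, sq]

/-- The kernel `exp (-k |x|)`, with values in `ℝ≥0∞`. -/
noncomputable def expKernel (k x : ℝ) : ENNReal := ENNReal.ofReal (Real.exp (-(k * |x|)))

lemma measurable_expKernel (k : ℝ) : Measurable (expKernel k) := by
  unfold expKernel; fun_prop

lemma lintegral_expKernel_lt_top {k : ℝ} (hk : 0 < k) : ∫⁻ x, expKernel k x < ⊤ := by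
  have := (integrable_exp_neg_mul_abs hk).lintegral_lt_top
  exact this

lemma eLpNorm_le_of_expKernel {k : ℝ} {c : ℝ≥0} {ψ g : ℝ → ℂ}
    (hg : MemLp g 2 volume)
    (h : ∀ x, ‖ψ x‖ₑ ≤ c * ∫⁻ y, expKernel k (x - y) * ‖g y‖ₑ) :
    eLpNorm ψ 2 volume ≤ c * (∫⁻ x, expKernel k x) * eLpNorm g 2 volume := by
  have e2 : ∀ f : ℝ → ℂ, eLpNorm f 2 volume = (∫⁻ x, ‖f x‖ₑ ^ (2 : ℝ)) ^ (1 / 2 : ℝ) := by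
    intro f
    rw [eLpNorm_eq_lintegral_rpow_enorm_toReal two_ne_zero ENNReal.ofNat_ne_top]
    simp
  have hh : (0 : ℝ) ≤ 1 / 2 := by norm_num
  rw [e2, e2]
  calc (∫⁻ x, ‖ψ x‖ₑ ^ (2 : ℝ)) ^ (1 / 2 : ℝ)
      ≤ (∫⁻ x, (c : ENNReal) ^ (2 : ℝ) *
          (∫⁻ y, expKernel k (x - y) * ‖g y‖ₑ) ^ (2 : ℝ)) ^ (1 / 2 : ℝ) := by
        refine ENNReal.rpow_le_rpow (lintegral_mono fun x => ?_) hh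
        dsimp only
        rw [← ENNReal.mul_rpow_of_nonneg _ _ zero_le_two]
        exact ENNReal.rpow_le_rpow (h x) zero_le_two
    _ ≤ ((c : ENNReal) ^ (2 : ℝ) *
          ((∫⁻ x, expKernel k x) ^ (2 : ℝ) * ∫⁻ y, ‖g y‖ₑ ^ (2 : ℝ))) ^ (1 / 2 : ℝ) := by
        refine ENNReal.rpow_le_rpow ?_ hh
        rw [lintegral_const_mul' _ _ (by simp)]
        gcongr
        exact lintegral_sq_convolution_le (measurable_expKernel k) hg.1.enorm
    _ = _ := by
        rw [ENNReal.mul_rpow_of_nonneg _ _ hh, ENNReal.mul_rpow_of_nonneg _ _ hh,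
          ← ENNReal.rpow_mul, ← ENNReal.rpow_mul]
        norm_num
        rw [mul_assoc]

section Green

variable {k C D : ℝ} {a b p m : ℝ → ℝ} {g : ℝ → ℂ}

lemma integrableOn_Iic_smul (hk : 0 < k) (hmc : Continuous m)
    (hm : ∀ x, |m x| ≤ C * Real.exp (k * x)) (hg : MemLp g 2 volume) (x : ℝ) :
    IntegrableOn (fun y => m y • g y) (Set.Iic x) volume := by
  have h1 : MemLp (fun y => Real.exp (k * y)) 2 (volume.restrict (Set.Iic x)) := by
    rw [memLp_two_iff_integrable_sq (by fun_prop)]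
    refine (integrableOn_exp_mul_Iic (a := 2 * k) (by positivity) x).congr
      (.of_forall fun y => ?_)
    simp only [← Real.exp_nat_mul]
    congr 1; push_cast; ring
  have h2 : MemLp m 2 (volume.restrict (Set.Iic x)) :=
    MemLp.of_le_mul (c := C) h1 hmc.aestronglyMeasurable (.of_forall fun y => by
      rw [Real.norm_of_nonneg (Real.exp_pos _).le]; exact hm y)
  exact memLp_one_iff_integrable.1 ((hg.restrict _).smul (r := 1) h2)

lemma integrableOn_Ioi_smul (hk : 0 < k) (hpc : Continuous p)
    (hp : ∀ x, |p x| ≤ D * Real.exp (-(k * x))) (hg : MemLp g 2 volume) (x : ℝ) :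
    IntegrableOn (fun y => p y • g y) (Set.Ioi x) volume := by
  have h1 : MemLp (fun y => Real.exp (-(k * y))) 2 (volume.restrict (Set.Ioi x)) := by
    rw [memLp_two_iff_integrable_sq (by fun_prop)]
    refine (integrableOn_exp_mul_Ioi (a := -(2 * k)) (by linarith) x).congr
      (.of_forall fun y => ?_)
    simp only [← Real.exp_nat_mul]
    congr 1; push_cast; ring
  have h2 : MemLp p 2 (volume.restrict (Set.Ioi x)) :=
    MemLp.of_le_mul (c := D) h1 hpc.aestronglyMeasurable (.of_forall fun y => by
      rw [Real.norm_of_nonneg (Real.exp_pos _).le]; exact hp y)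
  exact memLp_one_iff_integrable.1 ((hg.restrict _).smul (r := 1) h2)

/-- Green's function is dominated by `exp (-k |x - y|)`. -/
lemma enorm_green_le (hm : ∀ x, |m x| ≤ C * Real.exp (k * x))
    (hp : ∀ x, |p x| ≤ D * Real.exp (-(k * x))) (hb : ∀ x, |b x| ≤ C * Real.exp (k * x))
    (ha : ∀ x, |a x| ≤ D * Real.exp (-(k * x))) (x : ℝ) :
    ‖a x • (∫ y in Set.Iic x, m y • g y) + b x • ∫ y in Set.Ioi x, p y • g y‖ₑ ≤
      (C * D).toNNReal * ∫⁻ y, expKernel k (x - y) * ‖g y‖ₑ := by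
  have hC : 0 ≤ C := by
    have := (abs_nonneg _).trans (hm 0); simpa using this
  have key : ∀ (s t : ℝ → ℝ) (A : Set ℝ), MeasurableSet A →
      (∀ y ∈ A, |s x| * |t y| ≤ C * D * Real.exp (-(k * |x - y|))) →
      ‖s x • ∫ y in A, t y • g y‖ₑ ≤
        ∫⁻ y in A, ((C * D).toNNReal : ENNReal) * (expKernel k (x - y) * ‖g y‖ₑ) := by
    intro s t A hA hst
    rw [← integral_smul]
    refine (enorm_integral_le_lintegral_enorm _).trans ?_
    refine setLIntegral_mono' hA fun y hy => ?_
    rw [enorm_smul, enorm_smul, ← mul_assoc, ← mul_assoc]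
    refine mul_le_mul_left ?_ _
    rw [Real.enorm_eq_ofReal_abs, Real.enorm_eq_ofReal_abs, ← ENNReal.ofReal_mul (abs_nonneg _),
      expKernel]
    change _ ≤ ENNReal.ofReal (C * D) * ENNReal.ofReal _
    rw [← ENNReal.ofReal_mul' (Real.exp_pos _).le]
    exact ENNReal.ofReal_le_ofReal (hst y hy)
  refine (enorm_add_le _ _).trans ?_
  rw [← lintegral_const_mul' _ _ ENNReal.coe_ne_top,
    ← lintegral_add_compl _ (measurableSet_Iic (a := x)), Set.compl_Iic]
  refine add_le_add (key a m _ measurableSet_Iic fun y hy => ?_)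
    (key b p _ measurableSet_Ioi fun y hy => ?_)
  · have hy : y ≤ x := hy
    refine (mul_le_mul (ha x) (hm y) (abs_nonneg _) ((abs_nonneg _).trans (ha x))).trans_eq ?_
    rw [abs_of_nonneg (sub_nonneg.2 hy), show -(k * (x - y)) = -(k * x) + k * y by ring,
      Real.exp_add]
    ring
  · have hy : x < y := hy
    refine (mul_le_mul (hb x) (hp y) (abs_nonneg _) ((abs_nonneg _).trans (hb x))).trans_eq ?_
    rw [abs_of_neg (sub_neg.2 hy), show -(k * -(x - y)) = k * x + -(k * y) by ring,
      Real.exp_add]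
    ring

lemma isPrimitive_integral_Iic {h : ℝ → ℂ} (hl : LocallyIntegrable h volume)
    (hi : ∀ x, IntegrableOn h (Set.Iic x) volume) :
    IsPrimitive (fun x => ∫ y in Set.Iic x, h y) h :=
  ⟨hl, fun a b => intervalIntegral.integral_Iic_sub_Iic (hi a) (hi b)⟩

lemma isPrimitive_integral_Ioi {h : ℝ → ℂ} (hl : LocallyIntegrable h volume)
    (hi : ∀ x, IntegrableOn h (Set.Ioi x) volume) :
    IsPrimitive (fun x => ∫ y in Set.Ioi x, h y) (fun x => -h x) := by
  refine ⟨hl.neg, fun a b => ?_⟩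
  rw [intervalIntegral.integral_neg,
    ← intervalIntegral.integral_interval_add_Ioi (hi a) (hi b)]
  abel

end Green

/-- The right Jost solution: it equals `exp (-k (x - R))` to the right of the support. -/
lemma IsBoundedPotential.exists_right_jost {q : ℝ → ℝ} {M R : ℝ}
    (hq : IsBoundedPotential q M R) (k : ℝ) :
    ∃ χ χ₁ : ℝ → ℝ, IsPrimitive χ χ₁ ∧ IsPrimitive χ₁ (fun x => (q x + k ^ 2) * χ x) ∧
      χ R = 1 ∧ χ₁ R = -k := by
  obtain ⟨f, f₁, h1, h2, h3, h4⟩ := exists_solution (Q := fun x => q x + k ^ 2)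
    (hq.measurable.add_const _) (hq.abs_add_sq_le k) R 1 (-k)
  exact ⟨f, f₁, h1, h2, h3, h4⟩

/-- Variation of constants: if the left Jost solution does not decay on the right, the equation
`-ψ'' + q ψ + k² ψ = g` is solved with an `L²` bound by means of Green's function. -/
lemma exists_green_solution {q : ℝ → ℝ} {M R k : ℝ} (hq : IsBoundedPotential q M R) (hk : 0 < k)
    {φ φ₁ : ℝ → ℝ} (hφ : IsLeftJost q R k φ φ₁) (hne : φ₁ R + k * φ R ≠ 0) :
    ∃ K : ℝ≥0, ∀ g : ℝ → ℂ, MemLp g 2 volume → ∃ ψ ψ₁ : ℝ → ℂ, IsPrimitive ψ ψ₁ ∧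
      IsPrimitive ψ₁ (fun x => (q x + k ^ 2) • ψ x - g x) ∧ MemLp ψ 2 volume ∧
      MemLp ψ₁ 2 volume ∧ eLpNorm ψ 2 volume ≤ K * eLpNorm g 2 volume := by
  obtain ⟨χ, χ₁, hχ, hχ₁, hχR, hχ₁R⟩ := hq.exists_right_jost k
  obtain ⟨C, hC⟩ := exists_exp_bound_of_left_condition hq hk hφ.deriv hφ.deriv₁
    (by simp [hφ.left, hφ.left₁])
  obtain ⟨D, hD⟩ := exists_exp_bound_of_right_condition hq hk hχ hχ₁ (by simp [hχR, hχ₁R])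
  have hm : ∀ x, |φ x| ≤ C * Real.exp (k * x) := fun x =>
    (le_add_of_nonneg_right (norm_nonneg _)).trans (hC x)
  have hm₁ : ∀ x, |φ₁ x| ≤ C * Real.exp (k * x) := fun x =>
    (le_add_of_nonneg_left (norm_nonneg _)).trans (hC x)
  have hp : ∀ x, |χ x| ≤ D * Real.exp (-(k * x)) := fun x =>
    (le_add_of_nonneg_right (norm_nonneg _)).trans (hD x)
  have hp₁ : ∀ x, |χ₁ x| ≤ D * Real.exp (-(k * x)) := fun x =>
    (le_add_of_nonneg_left (norm_nonneg _)).trans (hD x)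
  set W := φ₁ R + k * φ R with hW
  -- the Wronskian of the two Jost solutions
  have hWr : ∀ x, φ₁ x * χ x - χ₁ x * φ x = W := by
    have h := (hφ.deriv₁.smul hχ).sub (hχ₁.smul hφ.deriv)
    intro x
    have h2 := h.sub_eq R x
    rw [intervalIntegral.integral_congr (g := fun _ => (0 : ℝ)) (fun y _ => by
      simp only [smul_eq_mul]; ring)] at h2
    simp only [smul_eq_mul, hχR, hχ₁R, intervalIntegral.integral_zero] at h2
    rw [hW]; linarith
  set c : ℝ≥0 := ‖W⁻¹‖₊ * (C * D).toNNReal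
  set I := ∫⁻ x, expKernel k x with hI
  have hIt : I ≠ ⊤ := (lintegral_expKernel_lt_top hk).ne
  refine ⟨c * I.toNNReal, fun g hg => ?_⟩
  have hgl : LocallyIntegrable g volume := hg.locallyIntegrable (by norm_num)
  have hloc : ∀ s : ℝ → ℝ, Continuous s → LocallyIntegrable (fun x => s x • g x) volume :=
    fun s hs => locallyIntegrableOn_univ.1 ((hgl.locallyIntegrableOn _).continuousOn_smul
      isOpen_univ.isLocallyClosed hs.continuousOn)
  have hA := isPrimitive_integral_Iic (hloc φ hφ.deriv.continuous)
    (integrableOn_Iic_smul hk hφ.deriv.continuous hm hg)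
  have hB := isPrimitive_integral_Ioi (hloc χ hχ.continuous)
    (integrableOn_Ioi_smul hk hχ.continuous hp hg)
  set A : ℝ → ℂ := fun x => ∫ y in Set.Iic x, φ y • g y
  set B : ℝ → ℂ := fun x => ∫ y in Set.Ioi x, χ y • g y
  have h1 : IsPrimitive (fun x => W⁻¹ • (χ x • A x + φ x • B x))
      (fun x => W⁻¹ • (χ₁ x • A x + φ₁ x • B x)) :=
    (((hχ.smul hA).add (hφ.deriv.smul hB)).const_smul W⁻¹).congr fun x => by
      simp only [smul_neg, smul_comm (φ x) (χ x)]
      module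
  have h2 : IsPrimitive (fun x => W⁻¹ • (χ₁ x • A x + φ₁ x • B x))
      (fun x => (q x + k ^ 2) • (W⁻¹ • (χ x • A x + φ x • B x)) - g x) :=
    (((hχ₁.smul hA).add (hφ.deriv₁.smul hB)).const_smul W⁻¹).congr fun x => by
      have e : g x = W⁻¹ • ((φ₁ x * χ x - χ₁ x * φ x) • g x) := by
        rw [hWr x, inv_smul_smul₀ hne]
      nth_rewrite 3 [e]
      module
  have b1 : ∀ x, ‖W⁻¹ • (χ x • A x + φ x • B x)‖ₑ ≤
      c * ∫⁻ y, expKernel k (x - y) * ‖g y‖ₑ := by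
    intro x
    rw [enorm_smul, ENNReal.coe_mul, mul_assoc]
    exact mul_le_mul_right (enorm_green_le hm hp hm hp x) _
  have b2 : ∀ x, ‖W⁻¹ • (χ₁ x • A x + φ₁ x • B x)‖ₑ ≤
      c * ∫⁻ y, expKernel k (x - y) * ‖g y‖ₑ := by
    intro x
    rw [enorm_smul, ENNReal.coe_mul, mul_assoc]
    exact mul_le_mul_right (enorm_green_le hm hp hm₁ hp₁ x) _
  have l1 := eLpNorm_le_of_expKernel hg b1
  have l2 := eLpNorm_le_of_expKernel hg b2
  rw [← hI, ← ENNReal.coe_toNNReal hIt, ← ENNReal.coe_mul] at l1 l2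
  have hfin : ((c * I.toNNReal : ℝ≥0) : ENNReal) * eLpNorm g 2 volume < ⊤ :=
    ENNReal.mul_lt_top ENNReal.coe_lt_top hg.2
  exact ⟨_, _, h1, h2, ⟨h1.continuous.aestronglyMeasurable, l1.trans_lt hfin⟩,
    ⟨h2.continuous.aestronglyMeasurable, l2.trans_lt hfin⟩, l1⟩

lemma inResolventSet_of_ne {q : ℝ → ℝ} {M R k : ℝ} (hq : IsBoundedPotential q M R) (hk : 0 < k)
    {φ φ₁ : ℝ → ℝ} (hφ : IsLeftJost q R k φ φ₁) (hne : φ₁ R + k * φ R ≠ 0) :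
    InResolventSet q (-k ^ 2) := by
  obtain ⟨K, hK⟩ := exists_green_solution hq hk hφ hne
  refine ⟨fun g hg => ?_, K, fun ψ f hψ => ?_⟩
  · obtain ⟨ψ, ψ₁, h1, h2, m, m₁, -⟩ := hK g hg
    refine ⟨ψ, schrodingerGraph_of_isPrimitive hq h1 (h2.congr fun x => ?_) m m₁
      (hg.add (m.const_mul _))⟩
    simp only [Complex.real_smul]
    push_cast; ring
  · obtain ⟨F, F₁, hψF, hF, hF₁, mF, mF₁⟩ := hψ.exists_isPrimitive
    have mf : MemLp f 2 volume := by
      obtain ⟨_, _, _, _, _, _, _, mf, _⟩ := hψ; exact mf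
    have mψ : MemLp ψ 2 volume := mF.ae_eq hψF.symm
    obtain ⟨Ψ, Ψ₁, h1, h2, m, m₁, hb⟩ :=
      hK (fun x => f x - ((-k ^ 2 : ℝ) : ℂ) * ψ x) (mf.sub (mψ.const_mul _))
    -- the difference to Green's solution would be an eigenfunction
    have hd : SchrodingerGraph q (fun x => F x - Ψ x)
        (fun x => ((-k ^ 2 : ℝ) : ℂ) * (F x - Ψ x)) := by
      refine schrodingerGraph_of_isPrimitive hq (hF.sub h1) ((hF₁.sub h2).congr_ae ?_)
        (mF.sub m) (mF₁.sub m₁) ((mF.sub m).const_mul _)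
      filter_upwards [hψF] with x hx
      simp only [hx, Complex.real_smul]
      push_cast; ring
    have hz : (fun x => F x - Ψ x) =ᵐ[volume] 0 := by
      by_contra hz
      exact hne ((isEigenvalue_iff hq hk hφ).1 ⟨_, hz, hd⟩)
    have : ψ =ᵐ[volume] Ψ := by
      filter_upwards [hψF, hz] with x hx hx'
      rw [hx]; exact sub_eq_zero.1 hx'
    rw [eLpNorm_congr_ae this]
    exact hb

/-- The half-bound state `u` of `-d²/dx² + q` with derivative `u₁`, described by its values outside
the support of `q`. -/
structure IsHalfBound (q : ℝ → ℝ) (R θ : ℝ) (u u₁ : ℝ → ℝ) : Prop where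
  deriv : IsPrimitive u u₁
  deriv₁ : IsPrimitive u₁ (fun x => q x * u x)
  left : ∀ x ≤ -R, u x = 1 ∧ u₁ x = 0
  right : ∀ x ≥ R, u x = θ ∧ u₁ x = 0

/-- An eventually affine function with a finite limit is eventually constant. -/
lemma eq_limit_of_isPrimitive_atTop {f f₁ : ℝ → ℝ} {R θ : ℝ} (hf : IsPrimitive f f₁)
    (h1 : ∀ x ≥ R, f₁ x = f₁ R) (hθ : Tendsto f atTop (𝓝 θ)) : ∀ x ≥ R, f x = θ ∧ f₁ x = 0 := by
  have hlin : ∀ x ≥ R, ∀ y ≥ x, f y - f x = (y - x) * f₁ R := by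
    intro x hx y hy
    rw [hf.sub_eq, intervalIntegral.integral_congr (g := fun _ => f₁ R)]
    · simp
    · intro t ht
      rw [Set.uIcc_of_le hy] at ht
      exact h1 t (hx.le.trans ht.1)
  have h0 : f₁ R = 0 := by
    have t1 : Tendsto (fun x => f (x + 1) - f x) atTop (𝓝 (θ - θ)) :=
      (hθ.comp (tendsto_atTop_add_const_right _ 1 tendsto_id)).sub hθ
    have t2 : Tendsto (fun x => f (x + 1) - f x) atTop (𝓝 (f₁ R)) := by
      refine tendsto_const_nhds.congr' ?_
      filter_upwards [eventually_ge_atTop R] with x hx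
      rw [hlin x hx (x + 1) (by linarith)]; ring
    rw [tendsto_nhds_unique t2 t1, sub_self]
  refine fun x hx => ⟨?_, by rw [h1 x hx, h0]⟩
  refine tendsto_nhds_unique (tendsto_const_nhds.congr' ?_) hθ
  filter_upwards [eventually_ge_atTop x] with y hy
  have := hlin x hx y hy
  rw [h0, mul_zero] at this
  linarith

lemma IsNormalizedHalfBoundState.exists_isHalfBound {U q u : ℝ → ℝ} {θ M R : ℝ}
    (hu : IsNormalizedHalfBoundState U u θ) (hUq : U =ᵐ[volume] q)
    (hq : IsBoundedPotential q M R) : ∃ u₁, IsHalfBound q R θ u u₁ := by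
  obtain ⟨⟨u₁, hd, hi⟩, -, hbot, htop⟩ := hu
  have huc : Continuous u := continuous_iff_continuousAt.2 fun x => (hd x).continuousAt
  have h2 : IsPrimitive u₁ (fun x => q x * u x) := by
    refine ⟨locallyIntegrable_mul_of_bound hq.measurable hq.abs_le huc, fun a b => ?_⟩
    rw [hi]
    refine intervalIntegral.integral_congr_ae ?_
    filter_upwards [hUq] with x hx _
    rw [hx]
  have h1 : IsPrimitive u u₁ := IsPrimitive.of_hasDerivAt hd h2.continuous
  have flat : ∀ {p v v₁ : ℝ → ℝ}, IsBoundedPotential p M R →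
      IsPrimitive v₁ (fun x => p x * v x) → ∀ x ≥ R, v₁ x = v₁ R := by
    intro p v v₁ hp hv x hx
    exact (hv.eq_of_ae_eq_zero hx (.of_forall fun t ht => by
      rw [hp.eq_zero t (ht.1.trans_le (le_abs_self t)), zero_mul])).symm
  refine ⟨u₁, h1, h2, fun x hx => ?_, eq_limit_of_isPrimitive_atTop h1 (flat hq h2) htop⟩
  obtain ⟨r1, r2⟩ := isPrimitive_reflect h1 h2
  have := eq_limit_of_isPrimitive_atTop r1 (flat hq.comp_neg r2)
    (hbot.comp tendsto_neg_atTop_atBot) (-x) (by linarith)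
  simpa using this

/-- The flux of a solution of `-ψ'' + q ψ = 1_[-R, R] u` through `±R` vanishes if `ψ` is in
`W₂²(ℝ)`, which is incompatible with the Wronskian identity for `ψ` and `u`. -/
lemma IsHalfBound.not_inResolventSet_zero {q u u₁ : ℝ → ℝ} {M R θ : ℝ}
    (hq : IsBoundedPotential q M R) (hu : IsHalfBound q R θ u u₁) : ¬ InResolventSet q 0 := by
  rintro ⟨hsurj, -⟩
  have huc := hu.deriv.continuous
  have hRR : -R < R := by linarith [hq.pos]
  set g : ℝ → ℂ := Set.indicator (Set.Icc (-R) R) fun x => (u x : ℂ) with hgdef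
  have hg : MemLp g 2 volume := by
    rw [hgdef, memLp_indicator_iff_restrict measurableSet_Icc]
    obtain ⟨B, hB⟩ := (isCompact_Icc (a := -R) (b := R)).exists_bound_of_continuousOn
      huc.continuousOn
    refine MemLp.of_bound (Complex.continuous_ofReal.comp huc).aestronglyMeasurable B ?_
    filter_upwards [ae_restrict_mem measurableSet_Icc] with x hx
    simpa using hB x hx
  obtain ⟨ψ, hψ⟩ := hsurj g hg
  obtain ⟨F, F₁, -, hF, hF₁, -, m₁⟩ := hψ.exists_isPrimitive
  have hout : ∀ t, R < |t| → q t • F t - (g t + ((0 : ℝ) : ℂ) * ψ t) = 0 := by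
    intro t ht
    have : t ∉ Set.Icc (-R) R := fun h => absurd (abs_le.2 h) (not_le.2 ht)
    rw [hq.eq_zero t ht, hgdef, Set.indicator_of_notMem this]
    simp
  have hFR : F₁ R = 0 := by
    refine eq_zero_of_memLp_of_norm_le (measurableSet_Ioi (a := R)) Real.volume_Ioi m₁
      fun x hx => ?_
    rw [hF₁.eq_of_ae_eq_zero (le_of_lt hx) (.of_forall fun t ht =>
      hout t (ht.1.trans_le (le_abs_self t)))]
  have hFR' : F₁ (-R) = 0 := by
    refine eq_zero_of_memLp_of_norm_le (measurableSet_Iio (a := -R)) Real.volume_Iio m₁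
      fun x hx => ?_
    rw [hF₁.eq_of_ae_eq_zero (le_of_lt hx)]
    filter_upwards [Measure.ae_ne volume (-R)] with t htR ht
    have : t < -R := lt_of_le_of_ne ht.2 htR
    exact hout t (by rw [lt_abs]; right; linarith)
  have hw := (hu.deriv.smul hF₁).sub (hu.deriv₁.smul hF)
  have h1 := hw.sub_eq (-R) R
  rw [hFR, hFR', (hu.left _ le_rfl).2, (hu.right _ le_rfl).2,
    intervalIntegral.integral_congr (g := fun x => ((-(u x ^ 2) : ℝ) : ℂ)),
    intervalIntegral.integral_ofReal] at h1
  · simp only [smul_zero, zero_smul, sub_zero] at h1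
    have h2 : ∫ x in (-R)..R, u x ^ 2 = 0 := by
      have := (Complex.ofReal_eq_zero.1 h1.symm)
      rwa [intervalIntegral.integral_neg, neg_eq_zero] at this
    have h3 : 0 < ∫ x in (-R)..R, u x ^ 2 := by
      refine intervalIntegral.integral_pos hRR (huc.pow 2).continuousOn
        (fun x _ => sq_nonneg _) ⟨-R, ⟨le_rfl, hRR.le⟩, ?_⟩
      rw [(hu.left _ le_rfl).1]; norm_num
    exact h3.ne' h2
  · intro x hx
    rw [Set.uIcc_of_le hRR.le] at hx
    simp only [hgdef, Set.indicator_of_mem hx, Complex.real_smul]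
    push_cast; ring

/-! ### The Jost function near the threshold -/

lemma IsBoundedPotential.add {q W : ℝ → ℝ} {M ε R : ℝ} (hq : IsBoundedPotential q M R)
    (hW : IsBoundedPotential W ε R) : IsBoundedPotential (fun x => q x + W x) (M + ε) R :=
  ⟨hq.measurable.add hW.measurable,
    fun x => (abs_add_le _ _).trans (add_le_add (hq.abs_le x) (hW.abs_le x)),
    fun x hx => by rw [hq.eq_zero x hx, hW.eq_zero x hx, add_zero], hq.pos⟩

/-- The Jost function `φ'(R) + k φ(R)` depends continuously on `k`. -/
lemma continuous_jost {q : ℝ → ℝ} {M R : ℝ} (hq : IsBoundedPotential q M R)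
    {φ φ₁ : ℝ → ℝ → ℝ} (hφ : ∀ k, IsLeftJost q R k (φ k) (φ₁ k)) :
    Continuous fun k => φ₁ k R + k * φ k R := by
  have hRR : -R ≤ R := by linarith [hq.pos]
  rw [continuous_iff_continuousAt]
  intro j
  have key : ∀ k, ‖φ k R - φ j R‖ + ‖φ₁ k R - φ₁ j R‖ ≤
      (|k - j| + |k ^ 2 - j ^ 2| * ∫ x in (-R)..R, ‖φ j x‖) *
        Real.exp ((1 + (M + k ^ 2)) * (R - -R)) := by
    intro k
    have h1 := (hφ k).deriv.sub (hφ j).deriv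
    have h2 : IsPrimitive (fun x => φ₁ k x - φ₁ j x)
        (fun x => (q x + k ^ 2) • (φ k x - φ j x) + (k ^ 2 - j ^ 2) * φ j x) :=
      ((hφ k).deriv₁.sub (hφ j).deriv₁).congr fun x => by simp only [smul_eq_mul]; ring
    have := norm_add_norm_le_of_isPrimitive hRR h1 h2
      (continuous_const.mul (hφ j).deriv.continuous).locallyIntegrable (hq.abs_add_sq_le k)
    simpa [(hφ k).left, (hφ j).left, (hφ k).left₁, (hφ j).left₁, abs_mul,
      intervalIntegral.integral_const_mul] using this
  have hlim : Tendsto (fun k => (|k - j| + |k ^ 2 - j ^ 2| * ∫ x in (-R)..R, ‖φ j x‖) *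
      Real.exp ((1 + (M + k ^ 2)) * (R - -R))) (𝓝 j) (𝓝 0) := by
    have : Continuous fun k => (|k - j| + |k ^ 2 - j ^ 2| * ∫ x in (-R)..R, ‖φ j x‖) *
      Real.exp ((1 + (M + k ^ 2)) * (R - -R)) := by fun_prop
    simpa using this.tendsto j
  have t1 : Tendsto (fun k => φ k R) (𝓝 j) (𝓝 (φ j R)) := by
    rw [tendsto_iff_norm_sub_tendsto_zero]
    exact squeeze_zero (fun k => norm_nonneg _)
      (fun k => (le_add_of_nonneg_right (norm_nonneg _)).trans (key k)) hlim
  have t2 : Tendsto (fun k => φ₁ k R) (𝓝 j) (𝓝 (φ₁ j R)) := by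
    rw [tendsto_iff_norm_sub_tendsto_zero]
    exact squeeze_zero (fun k => norm_nonneg _)
      (fun k => (le_add_of_nonneg_left (norm_nonneg _)).trans (key k)) hlim
  exact t2.add (tendsto_id.mul t1)

namespace IsHalfBound

variable {q u u₁ : ℝ → ℝ} {M R θ : ℝ}

/-- If `θ = 0`, then `u` and `u'` vanish at `R`, and so does the Wronskian of `u` with every other
solution. -/
lemma limit_ne_zero (hq : IsBoundedPotential q M R) (hu : IsHalfBound q R θ u u₁) : θ ≠ 0 := by
  rintro rfl
  obtain ⟨f, f₁, h1, h2, h3, h4⟩ := exists_solution hq.measurable hq.abs_le (-R) 0 1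
  have h := ((hu.deriv.smul h2).sub (hu.deriv₁.smul h1)).sub_eq (-R) R
  rw [intervalIntegral.integral_congr (g := fun _ => (0 : ℝ)) (fun y _ => by
    simp only [smul_eq_mul]; ring)] at h
  simp [(hu.left _ le_rfl).1, (hu.left _ le_rfl).2, (hu.right _ le_rfl).1, (hu.right _ le_rfl).2,
    h4] at h

/-- First order expansion of the Jost function of `q + W` for small `W` and `k`. The Wronskian
identity for `φ` and `u` expresses it by `∫ (W + k²) u φ`, and `φ` is close to `u`. -/
lemma exists_jost_expansion (hq : IsBoundedPotential q M R) (hu : IsHalfBound q R θ u u₁) :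
    ∃ C : ℝ, 0 ≤ C ∧ ∀ (W : ℝ → ℝ) (ε k : ℝ) (φ φ₁ : ℝ → ℝ), IsBoundedPotential W ε R → ε ≤ 1 →
      0 ≤ k → k ≤ 1 → IsLeftJost (fun x => q x + W x) R k φ φ₁ →
      |θ * (φ₁ R + k * φ R) - (k * (1 + θ ^ 2) + ∫ x in (-R)..R, W x * u x ^ 2)| ≤
        C * (ε + k) ^ 2 := by
  have huc := hu.deriv.continuous
  have hR := hq.pos
  have hM := hq.nonneg
  have hRR : -R ≤ R := by linarith
  obtain ⟨B, hB⟩ := (isCompact_Icc (a := -R) (b := R)).exists_bound_of_continuousOn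
    huc.continuousOn
  have hB0 : 0 ≤ B := (norm_nonneg _).trans (hB R ⟨hRR, le_rfl⟩)
  set C₀ := (1 + 2 * R * B) * Real.exp ((1 + (M + 2)) * (2 * R)) with hC₀
  have hC₀0 : 0 ≤ C₀ := by positivity
  refine ⟨|θ| * C₀ + 2 * R * (B * C₀) + 2 * R * (B * (B + 2 * C₀)), by positivity,
    fun W ε k φ φ₁ hW hε hk0 hk1 hφ => ?_⟩
  have hε0 : 0 ≤ ε := hW.nonneg
  set s := ε + k with hs
  have hs0 : 0 ≤ s := by positivity
  have hk2 : k ^ 2 ≤ k := by nlinarith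
  have hQ : ∀ x, |q x + W x + k ^ 2| ≤ M + 2 := by
    intro x
    have := (hq.add hW).abs_add_sq_le k x
    nlinarith
  have hWk : ∀ x, |W x + k ^ 2| ≤ s := fun x => (hW.abs_add_sq_le k x).trans (by linarith)
  have hWm : ∀ f : ℝ → ℝ, Continuous f → ∀ a b,
      IntervalIntegrable (fun x => W x * f x) volume a b := fun f hf =>
    (locallyIntegrable_mul_of_bound hW.measurable hW.abs_le hf).intervalIntegrable'
  have hd1 := hφ.deriv.sub hu.deriv
  have hd2 : IsPrimitive (fun x => φ₁ x - u₁ x)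
      (fun x => (q x + W x + k ^ 2) • (φ x - u x) + (W x + k ^ 2) * u x) :=
    (hφ.deriv₁.sub hu.deriv₁).congr fun x => by simp only [smul_eq_mul]; ring
  have hl : LocallyIntegrable (fun x => (W x + k ^ 2) * u x) volume :=
    locallyIntegrable_mul_of_bound (hW.measurable.add_const _) hWk huc
  -- `φ` is close to `u` on the support
  have hclose : ∀ x ∈ Set.Icc (-R) R, |φ x - u x| ≤ C₀ * s := by
    intro x hx
    have h1 := norm_add_norm_le_of_isPrimitive hx.1 hd1 hd2 hl hQ
    have h2 : ∫ t in (-R)..x, ‖(W t + k ^ 2) * u t‖ ≤ 2 * R * (s * B) := by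
      have h3 : ∫ t in (-R)..x, ‖(W t + k ^ 2) * u t‖ ≤ ∫ t in (-R)..x, s * B := by
        refine intervalIntegral.integral_mono_on hx.1 (hl.intervalIntegrable' _ _).norm
          intervalIntegrable_const fun t ht => ?_
        rw [norm_mul]
        exact mul_le_mul (hWk t) (hB t ⟨ht.1, ht.2.trans hx.2⟩) (norm_nonneg _) hs0
      rw [intervalIntegral.integral_const, smul_eq_mul] at h3
      refine h3.trans (mul_le_mul_of_nonneg_right ?_ (by positivity))
      linarith [hx.2]
    have h4 : Real.exp ((1 + (M + 2)) * (x - -R)) ≤ Real.exp ((1 + (M + 2)) * (2 * R)) := by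
      refine Real.exp_le_exp.2 (mul_le_mul_of_nonneg_left ?_ (by positivity))
      linarith [hx.2]
    rw [hφ.left, hφ.left₁, (hu.left _ le_rfl).1, (hu.left _ le_rfl).2, sub_self, sub_zero,
      norm_zero, zero_add, Real.norm_of_nonneg hk0] at h1
    have h5 : k + ∫ t in (-R)..x, ‖(W t + k ^ 2) * u t‖ ≤ (1 + 2 * R * B) * s := by nlinarith
    calc |φ x - u x| ≤ ‖φ x - u x‖ + ‖φ₁ x - u₁ x‖ := le_add_of_nonneg_right (norm_nonneg _)
      _ ≤ _ := h1
      _ ≤ ((1 + 2 * R * B) * s) * Real.exp ((1 + (M + 2)) * (2 * R)) :=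
        mul_le_mul h5 h4 (Real.exp_pos _).le (by positivity)
      _ = C₀ * s := by rw [hC₀]; ring
  have hs2 : s ≤ 2 := by linarith
  -- the Wronskian identity
  have i1 := hWm (fun x => u x ^ 2) (by fun_prop) (-R) R
  have hφc := hφ.deriv.continuous
  have i2 := hWm (fun x => u x * (φ x - u x)) (by fun_prop) (-R) R
  have i3 : IntervalIntegrable (fun x => k ^ 2 * (u x * φ x)) volume (-R) R :=
    Continuous.intervalIntegrable (by fun_prop) _ _
  have hw := ((hu.deriv.smul hφ.deriv₁).sub (hu.deriv₁.smul hφ.deriv)).sub_eq (-R) R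
  rw [intervalIntegral.integral_congr (g := fun x => W x * u x ^ 2 +
    (W x * (u x * (φ x - u x)) + k ^ 2 * (u x * φ x))) (fun y _ => by
      simp only [smul_eq_mul]; ring),
    intervalIntegral.integral_add i1 (i2.add i3), intervalIntegral.integral_add i2 i3] at hw
  simp only [smul_eq_mul, (hu.left _ le_rfl).1, (hu.left _ le_rfl).2, (hu.right _ le_rfl).1,
    (hu.right _ le_rfl).2, hφ.left, hφ.left₁, zero_mul, sub_zero, one_mul, mul_one] at hw
  have hI1 : |∫ x in (-R)..R, W x * (u x * (φ x - u x))| ≤ ε * (B * (C₀ * s)) * (2 * R) := by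
    have := intervalIntegral.norm_integral_le_of_norm_le_const (a := -R) (b := R)
      (f := fun x => W x * (u x * (φ x - u x))) (C := ε * (B * (C₀ * s))) (fun x hx => by
        rw [Set.uIoc_of_le hRR] at hx
        have hx' : x ∈ Set.Icc (-R) R := ⟨hx.1.le, hx.2⟩
        rw [norm_mul, norm_mul]
        exact mul_le_mul (hW.abs_le x) (mul_le_mul (hB x hx') (hclose x hx') (norm_nonneg _) hB0)
          (by positivity) hε0)
    rwa [abs_of_nonneg (by linarith), sub_neg_eq_add, ← two_mul] at this
  have hI2 : |∫ x in (-R)..R, k ^ 2 * (u x * φ x)| ≤ k ^ 2 * (B * (B + 2 * C₀)) * (2 * R) := by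
    have := intervalIntegral.norm_integral_le_of_norm_le_const (a := -R) (b := R)
      (f := fun x => k ^ 2 * (u x * φ x)) (C := k ^ 2 * (B * (B + 2 * C₀))) (fun x hx => by
        rw [Set.uIoc_of_le hRR] at hx
        have hx' : x ∈ Set.Icc (-R) R := ⟨hx.1.le, hx.2⟩
        rw [norm_mul, norm_mul, Real.norm_of_nonneg (sq_nonneg k)]
        refine mul_le_mul_of_nonneg_left (mul_le_mul (hB x hx') ?_ (norm_nonneg _) hB0)
          (sq_nonneg k)
        have h1 := hclose x hx'
        have h2 : |φ x| ≤ |u x| + |φ x - u x| := by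
          have := abs_add_le (u x) (φ x - u x)
          rwa [add_sub_cancel] at this
        have h3 : |u x| ≤ B := hB x hx'
        rw [Real.norm_eq_abs]
        nlinarith)
    rwa [abs_of_nonneg (by linarith), sub_neg_eq_add, ← two_mul] at this
  have hRc := hclose R ⟨hRR, le_rfl⟩
  rw [(hu.right _ le_rfl).1] at hRc
  have e : θ * (φ₁ R + k * φ R) - (k * (1 + θ ^ 2) + ∫ x in (-R)..R, W x * u x ^ 2) =
      θ * k * (φ R - θ) + ((∫ x in (-R)..R, W x * (u x * (φ x - u x))) +
        ∫ x in (-R)..R, k ^ 2 * (u x * φ x)) := by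
    linear_combination hw
  have hT : |θ * k * (φ R - θ)| ≤ |θ| * C₀ * s ^ 2 := by
    rw [abs_mul, abs_mul, abs_of_nonneg hk0]
    have hks : k ≤ s := by linarith
    calc |θ| * k * |φ R - θ| ≤ |θ| * s * (C₀ * s) := by gcongr
      _ = _ := by ring
  have h1' : ε * (B * (C₀ * s)) * (2 * R) ≤ 2 * R * (B * C₀) * s ^ 2 := by
    have hes : ε ≤ s := by linarith
    calc ε * (B * (C₀ * s)) * (2 * R) ≤ s * (B * (C₀ * s)) * (2 * R) := by gcongr
      _ = _ := by ring
  have h2' : k ^ 2 * (B * (B + 2 * C₀)) * (2 * R) ≤ 2 * R * (B * (B + 2 * C₀)) * s ^ 2 := by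
    have hks : k ≤ s := by linarith
    calc k ^ 2 * (B * (B + 2 * C₀)) * (2 * R) ≤ s ^ 2 * (B * (B + 2 * C₀)) * (2 * R) := by gcongr
      _ = _ := by ring
  rw [e]
  refine (abs_add_le _ _).trans ?_
  have := abs_add_le (∫ x in (-R)..R, W x * (u x * (φ x - u x)))
    (∫ x in (-R)..R, k ^ 2 * (u x * φ x))
  linarith

end IsHalfBound

/-! ### The first order term as a function of the scale -/

/-- The continuous representative of a compactly supported `W₂¹` potential. -/
lemma HasWeakDeriv.exists_isPrimitive_of_isPotential {V V' : ℝ → ℝ} (hV : IsPotential V)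
    (h : HasWeakDeriv V V') :
    ∃ (F : ℝ → ℝ) (S : ℝ), 0 < S ∧ V =ᵐ[volume] F ∧ IsPrimitive F V' ∧
      (∀ x, S ≤ |x| → F x = 0) ∧ ∀ᵐ x, S ≤ |x| → V' x = 0 := by
  obtain ⟨-, S, hS⟩ := hV
  obtain ⟨F, hVF, hF⟩ := h.exists_isPrimitive
  have ho : IsOpen {x : ℝ | S < |x|} := isOpen_lt continuous_const continuous_abs
  have hz : Set.EqOn F (fun _ => 0) {x : ℝ | S < |x|} := by
    refine Measure.eqOn_open_of_ae_eq (μ := volume) ?_ ho hF.continuous.continuousOn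
      continuousOn_const
    rw [EventuallyEq, ae_restrict_iff' ho.measurableSet]
    filter_upwards [hS, hVF] with x h1 h2 h3
    rw [← h2, h1 h3]
  have hlt : ∀ x, max S 0 + 1 ≤ |x| → S < |x| := fun x hx => by
    linarith [le_max_left S 0]
  refine ⟨F, max S 0 + 1, by positivity, hVF, hF, fun x hx => hz (hlt x hx), ?_⟩
  filter_upwards [hF.ae_hasDerivAt] with x hx hx'
  have h0 : F =ᶠ[𝓝 x] fun _ => 0 := by
    filter_upwards [ho.mem_nhds (hlt x hx')] with y hy using hz hy
  exact hx.unique ((hasDerivAt_const x (0 : ℝ)).congr_of_eventuallyEq h0)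

/-- The derivative of `a ↦ ∫ V (a x) u(x)² dx`. Integration by parts moves the dependence on `a`
from `V` to the primitive of `u²`, which is continuously differentiable. -/
lemma hasDerivAt_integral_comp_mul {V V' u : ℝ → ℝ} {B a₀ : ℝ} (hV : IsPotential V)
    (hVV' : HasWeakDeriv V V') (hu : Continuous u) (hB : ∀ x, |u x| ≤ B) (ha₀ : 0 < a₀) :
    HasDerivAt (fun a => ∫ x, V (a * x) * u x ^ 2) (∫ x, x * V' (a₀ * x) * u x ^ 2) a₀ := by
  obtain ⟨F, S, hS, hVF, hF, hF0, hV'0⟩ := hVV'.exists_isPrimitive_of_isPotential hV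
  have hV'i : Integrable V' volume := by
    have h1 : IntegrableOn V' (Set.Icc (-S) S) volume :=
      hF.locallyIntegrable.integrableOn_isCompact isCompact_Icc
    refine h1.integrable_of_ae_notMem_eq_zero ?_
    filter_upwards [hV'0] with x hx hx'
    refine hx (not_lt.1 fun h => hx' (abs_le.1 h.le))
  obtain ⟨P, hPd⟩ : ∃ P : ℝ → ℝ, ∀ x, HasDerivAt P (u x ^ 2) x :=
    ⟨_, (IsPrimitive.integral (hu.pow 2).locallyIntegrable 0 0).hasDerivAt (hu.pow 2)⟩
  have hPc : Continuous P := continuous_iff_continuousAt.2 fun x => (hPd x).continuousAt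
  have hparts : ∀ a, 0 < a → ∫ x, V (a * x) * u x ^ 2 = -∫ y, V' y * P (y / a) := by
    intro a ha
    have hp : IsPrimitive (fun y => P (y / a)) (fun y => u (y / a) ^ 2 * (1 / a)) :=
      IsPrimitive.of_hasDerivAt
        (fun y => HasDerivAt.comp (h₂ := P) y (hPd (y / a)) ((hasDerivAt_id y).div_const a))
        (by fun_prop)
    have h0 := (hp.smul hF).sub_eq (-S) S
    have hSS : -S ≤ S := by linarith
    have i1 : IntervalIntegrable (fun y => (u (y / a) ^ 2 * (1 / a)) • F y) volume (-S) S := by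
      have := hF.continuous
      exact Continuous.intervalIntegrable (by fun_prop) _ _
    have i2 : IntervalIntegrable (fun y => P (y / a) • V' y) volume (-S) S :=
      (hF.intervalIntegrable _ _).continuousOn_mul (by fun_prop)
    have hmem : ∀ x, x ∉ Set.Ioc (-S) S → S ≤ |x| := fun x hx => by
      by_contra h
      have := abs_lt.1 (not_le.1 h)
      exact hx ⟨this.1, this.2.le⟩
    rw [hF0 S (le_abs_self S), hF0 (-S) (by rw [abs_neg]; exact le_abs_self S),
      intervalIntegral.integral_add i1 i2, intervalIntegral.integral_of_le hSS,
      intervalIntegral.integral_of_le hSS, setIntegral_eq_integral_of_forall_compl_eq_zero,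
      setIntegral_eq_integral_of_ae_compl_eq_zero] at h0
    · have e1 := Measure.integral_comp_mul_left (fun y => V y * u (y / a) ^ 2) a
      simp only [mul_div_cancel_left₀ _ ha.ne'] at e1
      rw [e1, abs_of_pos (inv_pos.2 ha), ← integral_smul]
      have e2 : ∫ y, a⁻¹ • (V y * u (y / a) ^ 2) = ∫ y, (u (y / a) ^ 2 * (1 / a)) • F y := by
        refine integral_congr_ae ?_
        filter_upwards [hVF] with y hy
        simp only [hy, smul_eq_mul]; ring
      have e3 : ∫ y, V' y * P (y / a) = ∫ y, P (y / a) • V' y :=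
        integral_congr_ae (.of_forall fun y => by simp only [smul_eq_mul]; ring)
      rw [e2, e3]
      simp only [smul_zero, sub_zero] at h0
      linarith
    · filter_upwards [hV'0] with x hx hx'
      rw [hx (hmem x hx'), smul_zero]
    · intro x hx
      rw [hF0 x (hmem x hx), smul_zero]
  have hball : ∀ a ∈ Metric.ball a₀ (a₀ / 2), a₀ / 2 < a := by
    intro a ha
    rw [Metric.mem_ball, Real.dist_eq] at ha
    linarith [(abs_lt.1 ha).1]
  have hderiv := (hasDerivAt_integral_of_dominated_loc_of_deriv_le (μ := volume) (x₀ := a₀)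
    (s := Metric.ball a₀ (a₀ / 2)) (F := fun a y => V' y * P (y / a))
    (F' := fun a y => V' y * (u (y / a) ^ 2 * (y * -(a ^ 2)⁻¹)))
    (bound := fun y => ‖V' y‖ * (B ^ 2 * (S * ((a₀ / 2) ^ 2)⁻¹)))
    (Metric.ball_mem_nhds a₀ (by positivity))
    (.of_forall fun a =>
      hV'i.1.mul (by fun_prop : Continuous fun y => P (y / a)).aestronglyMeasurable)
    ?_ (hV'i.1.mul (by fun_prop : Continuous fun y =>
      (u (y / a₀) ^ 2 * (y * -(a₀ ^ 2)⁻¹))).aestronglyMeasurable) ?_ (hV'i.norm.mul_const _) ?_).2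
  · have hG := (hderiv.neg).congr_of_eventuallyEq (f₁ := fun a => ∫ x, V (a * x) * u x ^ 2) (by
      filter_upwards [lt_mem_nhds ha₀] with a ha using hparts a ha)
    refine hG.congr_deriv ?_
    have e1 := Measure.integral_comp_mul_left (fun y => y / a₀ * V' y * u (y / a₀) ^ 2) a₀
    simp only [mul_div_cancel_left₀ _ ha₀.ne'] at e1
    rw [e1, abs_of_pos (inv_pos.2 ha₀), ← integral_smul, ← integral_neg]
    refine integral_congr_ae (.of_forall fun y => ?_)
    simp only [smul_eq_mul]
    field_simp
  · -- `P (y / a₀)` is bounded on the support of `V'`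
    obtain ⟨K, hK⟩ := (isCompact_Icc (a := -S) (b := S)).exists_bound_of_continuousOn
      (f := fun y => P (y / a₀)) (by fun_prop)
    refine (hV'i.norm.mul_const K).mono'
      (hV'i.1.mul (by fun_prop : Continuous fun y => P (y / a₀)).aestronglyMeasurable) ?_
    filter_upwards [hV'0] with y hy
    rcases le_total S |y| with h | h
    · simp [hy h]
    · rw [norm_mul]
      exact mul_le_mul_of_nonneg_left (hK y (abs_le.1 h)) (norm_nonneg _)
  · filter_upwards [hV'0] with y hy a ha
    rcases le_total S |y| with h | h
    · simp [hy h]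
    · have ha' := hball a ha
      have hB0 : 0 ≤ B := (abs_nonneg _).trans (hB 0)
      have h1 : |u (y / a)| ^ 2 ≤ B ^ 2 := by
        have := hB (y / a); gcongr
      have h2 : (a ^ 2)⁻¹ ≤ ((a₀ / 2) ^ 2)⁻¹ := by gcongr
      rw [norm_mul, norm_mul, norm_pow, norm_mul, norm_neg, norm_inv, norm_pow]
      simp only [Real.norm_eq_abs, sq_abs] at h1 ⊢
      gcongr
  · refine .of_forall fun y a ha => ?_
    have ha' := hball a ha
    have ha0 : a ≠ 0 := by linarith
    have h1 := HasDerivAt.comp (h₂ := P) a (hPd (y / a)) ((hasDerivAt_inv ha0).const_mul y)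
    exact h1.const_mul (V' y)

/-! ### Asymptotics of the threshold eigenvalue -/

section Asymptotics

variable {ι : Type*} {F : Filter ι} {k A l δ : ι → ℝ} {C c T : ℝ}

/-- If `k → 0` solves `k T + A = O((l + k)²)` with `A ~ -c T l δ`, then `k ~ c l δ`. -/
lemma tendsto_div_of_abs_le (hT : 0 < T) (hC : 0 ≤ C)
    (hl : ∀ᶠ i in F, 0 < l i) (hδ : ∀ᶠ i in F, 0 < δ i) (hk0 : ∀ᶠ i in F, 0 < k i)
    (hk : Tendsto k F (𝓝 0)) (hlδ : Tendsto (fun i => l i / δ i) F (𝓝 0))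
    (hA : Tendsto (fun i => A i / (l i * δ i)) F (𝓝 (-(c * T))))
    (h : ∀ᶠ i in F, |k i * T + A i| ≤ C * (l i + k i) ^ 2) :
    Tendsto (fun i => k i / (l i * δ i)) F (𝓝 c) := by
  set κ : ι → ℝ := fun i => k i / (l i * δ i)
  set a : ι → ℝ := fun i => A i / (l i * δ i)
  have h1 : ∀ᶠ i in F, |κ i * T + a i| ≤ 2 * C * (l i / δ i) + 2 * C * k i * κ i := by
    filter_upwards [hl, hδ, hk0, h] with i hl hδ hk0 h
    have hp : 0 < l i * δ i := mul_pos hl hδ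
    have e : κ i * T + a i = (k i * T + A i) / (l i * δ i) := by
      simp only [κ, a]; ring
    rw [e, abs_div, abs_of_pos hp, div_le_iff₀ hp]
    refine h.trans ?_
    have e2 : (2 * C * (l i / δ i) + 2 * C * k i * κ i) * (l i * δ i) =
        C * (2 * l i ^ 2 + 2 * k i ^ 2) := by
      simp only [κ]; field_simp
    rw [e2]
    exact mul_le_mul_of_nonneg_left (by nlinarith [sq_nonneg (l i - k i)]) hC
  -- `κ` stays bounded, since `2 C k κ` can be absorbed
  set K := 2 * (|c * T| + 1 + 1) / T
  have hK : ∀ᶠ i in F, κ i ≤ K := by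
    have hk' : ∀ᶠ i in F, 2 * C * k i < T / 2 := by
      have : Tendsto (fun i => 2 * C * k i) F (𝓝 (2 * C * 0)) := hk.const_mul _
      rw [mul_zero] at this
      exact this.eventually_lt_const (by positivity)
    have hl' : ∀ᶠ i in F, 2 * C * (l i / δ i) < 1 := by
      have : Tendsto (fun i => 2 * C * (l i / δ i)) F (𝓝 (2 * C * 0)) := hlδ.const_mul _
      rw [mul_zero] at this
      exact this.eventually_lt_const one_pos
    have ha' : ∀ᶠ i in F, |a i| < |c * T| + 1 := by
      have := hA.abs
      rw [abs_neg] at this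
      exact this.eventually_lt_const (lt_add_one _)
    filter_upwards [h1, hk', hl', ha', hl, hδ, hk0] with i h1 h2 h3 h4 hl hδ hk0
    have hκ : 0 < κ i := div_pos hk0 (mul_pos hl hδ)
    rw [le_div_iff₀ hT]
    have h5 := (le_abs_self _).trans h1
    have h6 := neg_abs_le (a i)
    nlinarith
  have h2 : Tendsto (fun i => 2 * C * (l i / δ i) + 2 * C * k i * K) F (𝓝 0) := by
    have := (hlδ.const_mul (2 * C)).add ((hk.const_mul (2 * C)).mul_const K)
    simpa using this
  have h3 : Tendsto (fun i => κ i * T + a i) F (𝓝 0) := by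
    refine squeeze_zero_norm' ?_ h2
    filter_upwards [h1, hK, hk0] with i h1 h2 hk0
    refine h1.trans ?_
    have : 2 * C * k i * κ i ≤ 2 * C * k i * K := mul_le_mul_of_nonneg_left h2 (by positivity)
    linarith
  have h4 := (h3.sub hA).div_const T
  have e : (0 - -(c * T)) / T = c := by field_simp; ring
  rw [e] at h4
  refine h4.congr fun i => ?_
  rw [add_sub_cancel_right, mul_div_cancel_right₀ _ hT.ne']

/-- With `k = x l δ`, the quadratic error in the expansion of the Jost function is `o(l δ)`. The
next two lemmas conclude that the error does not affect the sign of the Jost function for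
`x ≠ c`. -/
lemma tendsto_error_div (hl : ∀ᶠ i in F, 0 < l i) (hδ : ∀ᶠ i in F, 0 < δ i)
    (hδ0 : Tendsto δ F (𝓝 0)) (hlδ : Tendsto (fun i => l i / δ i) F (𝓝 0)) (C x : ℝ) :
    Tendsto (fun i => C * (l i + x * (l i * δ i)) ^ 2 / (l i * δ i)) F (𝓝 0) := by
  have : Tendsto (fun i => C * ((l i / δ i) * (1 + x * δ i) ^ 2)) F
      (𝓝 (C * (0 * (1 + x * 0) ^ 2))) :=
    (hlδ.mul ((tendsto_const_nhds.add (hδ0.const_mul x)).pow 2)).const_mul C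
  simp only [mul_zero, zero_mul] at this
  refine this.congr' ?_
  filter_upwards [hl, hδ] with i hl hδ
  field_simp

lemma eventually_error_lt (hT : 0 < T) (hl : ∀ᶠ i in F, 0 < l i) (hδ : ∀ᶠ i in F, 0 < δ i)
    (hδ0 : Tendsto δ F (𝓝 0)) (hlδ : Tendsto (fun i => l i / δ i) F (𝓝 0))
    (hA : Tendsto (fun i => A i / (l i * δ i)) F (𝓝 (-(c * T)))) (C : ℝ) {x : ℝ} (hx : c < x) :
    ∀ᶠ i in F, C * (l i + x * (l i * δ i)) ^ 2 < x * (l i * δ i) * T + A i := by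
  have h1 := tendsto_error_div hl hδ hδ0 hlδ C x
  have h2 : Tendsto (fun i => x * T + A i / (l i * δ i)) F (𝓝 (x * T + -(c * T))) :=
    hA.const_add _
  filter_upwards [h1.eventually_lt h2 (by nlinarith), hl, hδ] with i h hl hδ
  have hp : 0 < l i * δ i := mul_pos hl hδ
  rw [div_lt_iff₀ hp, add_mul, div_mul_cancel₀ _ hp.ne'] at h
  linarith

lemma eventually_lt_neg_error (hT : 0 < T) (hl : ∀ᶠ i in F, 0 < l i) (hδ : ∀ᶠ i in F, 0 < δ i)
    (hδ0 : Tendsto δ F (𝓝 0)) (hlδ : Tendsto (fun i => l i / δ i) F (𝓝 0))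
    (hA : Tendsto (fun i => A i / (l i * δ i)) F (𝓝 (-(c * T)))) (C : ℝ) {x : ℝ} (hx : x < c) :
    ∀ᶠ i in F, x * (l i * δ i) * T + A i < -(C * (l i + x * (l i * δ i)) ^ 2) := by
  have h1 := (tendsto_error_div hl hδ hδ0 hlδ C x).neg
  have h2 : Tendsto (fun i => x * T + A i / (l i * δ i)) F (𝓝 (x * T + -(c * T))) :=
    hA.const_add _
  filter_upwards [h2.eventually_lt h1 (by nlinarith), hl, hδ] with i h hl hδ
  have hp : 0 < l i * δ i := mul_pos hl hδ
  rw [← neg_div, lt_div_iff₀ hp, add_mul, div_mul_cancel₀ _ hp.ne'] at h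
  linarith

end Asymptotics

lemma IsBoundedPotential.mono {q : ℝ → ℝ} {M M' R R' : ℝ} (hq : IsBoundedPotential q M R)
    (hM : M ≤ M') (hR : R ≤ R') : IsBoundedPotential q M' R' :=
  ⟨hq.measurable, fun x => (hq.abs_le x).trans hM, fun x hx => hq.eq_zero x (hR.trans_lt hx),
    hq.pos.trans_le hR⟩

lemma IsBoundedPotential.scale {p : ℝ → ℝ} {N S l a b : ℝ} (hp : IsBoundedPotential p N S)
    (hl : 0 ≤ l) (hb : 0 < b) (hba : b ≤ a) :
    IsBoundedPotential (fun x => l * a * p (a * x)) (l * a * N) (S / b) := by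
  have ha : 0 < a := hb.trans_le hba
  refine ⟨(hp.measurable.comp (measurable_const_mul a)).const_mul _, fun x => ?_, fun x hx => ?_,
    div_pos hp.pos hb⟩
  · rw [abs_mul, abs_of_nonneg (by positivity)]
    exact mul_le_mul_of_nonneg_left (hp.abs_le _) (by positivity)
  · rw [hp.eq_zero, mul_zero]
    rw [abs_mul, abs_of_pos ha]
    rw [div_lt_iff₀ hb] at hx
    nlinarith [abs_nonneg x]

lemma ae_comp_mul_left {V p : ℝ → ℝ} (h : V =ᵐ[volume] p) {a : ℝ} (ha : a ≠ 0) :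
    ∀ᵐ x, V (a * x) = p (a * x) := by
  have hq : Measure.QuasiMeasurePreserving (fun x : ℝ => a * x) volume volume := by
    refine ⟨measurable_const_mul a, ?_⟩
    rw [Real.map_volume_mul_left ha]
    exact Measure.smul_absolutelyContinuous
  exact hq.ae h

/-- A half-bound state keeps the negative eigenvalues away from zero. -/
lemma IsHalfBound.exists_isGapBelowZero {q u u₁ : ℝ → ℝ} {M R θ : ℝ}
    (hq : IsBoundedPotential q M R) (hu : IsHalfBound q R θ u u₁) :
    ∃ a, IsGapBelowZero q a := by
  obtain ⟨C, hC, hexp⟩ := hu.exists_jost_expansion hq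
  refine ⟨-(1 / (C + 1)) ^ 2, neg_lt_zero.2 (by positivity), fun z hz => ?_,
    hu.not_inResolventSet_zero hq⟩
  set k := √(-z) with hk
  have hk0 : 0 < k := Real.sqrt_pos.2 (by linarith [hz.2])
  have hkz : z = -k ^ 2 := by rw [hk, Real.sq_sqrt (by linarith [hz.2])]; ring
  have hk1 : k < 1 / (C + 1) := by
    rw [hk, Real.sqrt_lt' (by positivity)]; linarith [hz.1]
  have hk1' : k * (C + 1) < 1 := by rwa [lt_div_iff₀ (by positivity)] at hk1
  obtain ⟨φ, φ₁, hφ⟩ := hq.exists_isLeftJost k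
  rw [hkz]
  refine inResolventSet_of_ne hq hk0 hφ fun h0 => ?_
  have hW : IsBoundedPotential (fun _ => 0) 0 R :=
    ⟨measurable_const, fun _ => by simp, fun _ _ => rfl, hq.pos⟩
  have := hexp (fun _ => 0) 0 k φ φ₁ hW zero_le_one hk0.le (by nlinarith) (by simpa using hφ)
  simp only [h0, mul_zero, zero_mul, intervalIntegral.integral_zero, add_zero, zero_add, zero_sub,
    abs_neg] at this
  rw [abs_of_nonneg (by positivity)] at this
  nlinarith [mul_pos hk0 hk0, mul_nonneg hk0.le (sq_nonneg θ)]

/-- The rate at which `α` leaves `α₀` makes `l` negligible against `α - α₀`. -/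
lemma tendsto_div_of_rate {δ : ℝ → ℝ}
    (h : Tendsto (fun l : ℝ => l ^ (-(1 / 3) : ℝ) * δ l) (𝓝[>] 0) atTop) :
    Tendsto (fun l => l / δ l) (𝓝[>] 0) (𝓝 0) := by
  have h1 : Tendsto (fun l : ℝ => l ^ (2 / 3 : ℝ)) (𝓝[>] 0) (𝓝 0) := by
    have : ContinuousAt (fun l : ℝ => l ^ (2 / 3 : ℝ)) 0 :=
      Real.continuousAt_rpow_const _ _ (.inr (by norm_num))
    have h2 := this.tendsto
    rw [Real.zero_rpow (by norm_num)] at h2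
    exact h2.mono_left nhdsWithin_le_nhds
  refine (h1.div_atTop h).congr' ?_
  filter_upwards [self_mem_nhdsWithin] with l (hl : 0 < l)
  have e : l ^ (2 / 3 : ℝ) = l * l ^ (-(1 / 3) : ℝ) := by
    rw [← Real.rpow_one_add' hl.le (by norm_num)]; norm_num
  rw [e, mul_comm (l ^ (-(1 / 3) : ℝ)), mul_div_mul_right _ _ (Real.rpow_pos_of_pos hl _).ne']

/-- The facts about `-d²/dx² + U + l α_l V(α_l ·)` on which the theorem rests: `d l` is the Jost
function, whose positive zeros are the eigenvalues, and `A l` is the first order term. -/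
lemma exists_jost_family {U V V' u α : ℝ → ℝ} {θ α₀ : ℝ} (hU : IsPotential U)
    (hV : IsPotential V) (hVV' : HasWeakDeriv V V')
    (hu : IsNormalizedHalfBoundState U u θ) (hα₀ : 0 < α₀)
    (hlim : Tendsto α (𝓝[>] 0) (𝓝 α₀)) (hδ : ∀ᶠ l in 𝓝[>] (0 : ℝ), 0 < α l - α₀)
    (hzero : ∫ x : ℝ, V (α₀ * x) * u x ^ 2 = 0) :
    θ ≠ 0 ∧ (∃ a, IsGapBelowZero U a) ∧ ∃ (C : ℝ) (A : ℝ → ℝ) (d : ℝ → ℝ → ℝ), 0 ≤ C ∧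
      Tendsto (fun l => A l / (l * (α l - α₀))) (𝓝[>] 0)
        (𝓝 (α₀ * ∫ x : ℝ, x * V' (α₀ * x) * u x ^ 2)) ∧
      ∀ᶠ l in 𝓝[>] (0 : ℝ), Continuous (d l) ∧
        (∀ k, 0 < k →
          (IsEigenvalue (fun x => U x + l * α l * V (α l * x)) (-k ^ 2) ↔ d l k = 0)) ∧
        ∀ k, 0 ≤ k → k ≤ 1 →
          |θ * d l k - (k * (1 + θ ^ 2) + A l)| ≤ C * (l + k) ^ 2 := by
  obtain ⟨q, M, R₀, hUq, hq₀⟩ := hU.exists_isBoundedPotential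
  obtain ⟨p, N, S, hVp, hp⟩ := hV.exists_isBoundedPotential
  set R := max R₀ (S / (α₀ / 2)) with hR
  have hq : IsBoundedPotential q M R := hq₀.mono le_rfl (le_max_left _ _)
  obtain ⟨u₁, hu₁⟩ := hu.exists_isHalfBound hUq hq
  obtain ⟨C₀, hC₀, hexp⟩ := hu₁.exists_jost_expansion hq
  obtain ⟨B, hB⟩ := hu.2.1
  have hN := hp.nonneg
  have hRpos := hq.pos
  have hgap : ∃ a, IsGapBelowZero U a := by
    obtain ⟨a, ha, h1, h2⟩ := hu₁.exists_isGapBelowZero hq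
    exact ⟨a, ha, fun z hz => (h1 z hz).congr_ae hUq.symm, fun h => h2 (h.congr_ae hUq)⟩
  -- a Jost solution for every `l`, with a junk value for those `l` (not close to zero) for which
  -- the perturbation is not supported in `[-R, R]`
  have hjost : ∀ l k, ∃ φφ₁ : (ℝ → ℝ) × (ℝ → ℝ), ∀ ε,
      IsBoundedPotential (fun x => l * α l * p (α l * x)) ε R →
      IsLeftJost (fun x => q x + l * α l * p (α l * x)) R k φφ₁.1 φφ₁.2 := by
    intro l k
    by_cases h : ∃ ε, IsBoundedPotential (fun x => l * α l * p (α l * x)) ε R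
    · obtain ⟨ε, hε⟩ := h
      obtain ⟨φ, φ₁, hφ⟩ := (hq.add hε).exists_isLeftJost k
      exact ⟨(φ, φ₁), fun _ _ => hφ⟩
    · exact ⟨(0, 0), fun ε hε => absurd ⟨ε, hε⟩ h⟩
  choose Φ hΦ using hjost
  set G : ℝ → ℝ := fun a => ∫ x, V (a * x) * u x ^ 2 with hG
  set K := 2 * α₀ * N with hK
  have hK0 : 0 ≤ K := by positivity
  refine ⟨hu₁.limit_ne_zero hq, hgap, C₀ * (K + 1) ^ 2, fun l => l * α l * G (α l),
    fun l k => (Φ l k).2 R + k * (Φ l k).1 R, by positivity, ?_, ?_⟩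
  · have hd := hasDerivAt_integral_comp_mul hV hVV' hu₁.deriv.continuous hB hα₀
    have hs := hd.tendsto_slope.comp (tendsto_nhdsWithin_iff.2 ⟨hlim, by
      filter_upwards [hδ] with l hl using fun h => by
        have : α l = α₀ := h
        linarith⟩)
    refine (hlim.mul hs).congr' ?_
    filter_upwards [hδ, self_mem_nhdsWithin] with l hl (hl0 : 0 < l)
    have : G α₀ = 0 := hzero
    simp only [Function.comp_apply, slope_def_field]
    change α l * ((G (α l) - G α₀) / (α l - α₀)) = _
    rw [this, sub_zero]
    field_simp
  · have ev1 : ∀ᶠ l in 𝓝[>] (0 : ℝ), α₀ / 2 < α l := hlim.eventually_const_lt (by linarith)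
    have ev2 : ∀ᶠ l in 𝓝[>] (0 : ℝ), α l < 2 * α₀ := hlim.eventually_lt_const (by linarith)
    have ev3 : ∀ᶠ l in 𝓝[>] (0 : ℝ), l < 1 / (K + 1) :=
      (tendsto_id.mono_left nhdsWithin_le_nhds : Tendsto (fun l : ℝ => l) (𝓝[>] 0) (𝓝 0)
        ).eventually_lt_const (by positivity)
    filter_upwards [ev1, ev2, ev3, self_mem_nhdsWithin] with l h1 h2 h3 (hl : 0 < l)
    have hαl : 0 < α l := by linarith
    have hε : l * α l * N ≤ K * l := by
      rw [hK]
      calc l * α l * N ≤ l * (2 * α₀) * N := by gcongr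
        _ = _ := by ring
    have hKl : K * l ≤ 1 := by
      rw [lt_div_iff₀ (by positivity)] at h3
      nlinarith
    have hW : IsBoundedPotential (fun x => l * α l * p (α l * x)) (K * l) R :=
      (hp.scale hl.le (by linarith : (0 : ℝ) < α₀ / 2) h1.le).mono hε (le_max_right _ _)
    have hae : (fun x => U x + l * α l * V (α l * x)) =ᵐ[volume]
        fun x => q x + l * α l * p (α l * x) := by
      filter_upwards [hUq, ae_comp_mul_left hVp hαl.ne'] with x hx hx'
      rw [hx, hx']
    refine ⟨continuous_jost (φ := fun k => (Φ l k).1) (φ₁ := fun k => (Φ l k).2) (hq.add hW)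
      fun k => hΦ l k _ hW, fun k hk => ?_, fun k hk0 hk1 => ?_⟩
    · rw [← isEigenvalue_iff (hq.add hW) hk (hΦ l k _ hW)]
      exact ⟨fun h => h.congr_ae hae, fun h => h.congr_ae hae.symm⟩
    · have h4 := hexp _ _ _ _ _ hW hKl hk0 hk1 (hΦ l k _ hW)
      have e : ∫ x in (-R)..R, l * α l * p (α l * x) * u x ^ 2 = l * α l * G (α l) := by
        rw [intervalIntegral.integral_of_le (by linarith),
          setIntegral_eq_integral_of_ae_compl_eq_zero, hG, ← integral_const_mul]
        · refine integral_congr_ae ?_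
          filter_upwards [ae_comp_mul_left hVp hαl.ne'] with x hx
          rw [hx]; ring
        · filter_upwards [Measure.ae_ne volume (-R)] with x hx hx'
          have : R < |x| := by
            by_contra h
            have := abs_le.1 (not_lt.1 h)
            exact hx' ⟨lt_of_le_of_ne this.1 (Ne.symm hx), this.2⟩
          rw [hW.eq_zero x this, zero_mul]
      rw [e] at h4
      refine h4.trans ?_
      have h5 : K * l + k ≤ (K + 1) * (l + k) := by nlinarith [mul_nonneg hK0 hk0]
      have h6 : (K * l + k) ^ 2 ≤ ((K + 1) * (l + k)) ^ 2 :=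
        pow_le_pow_left₀ (by positivity) h5 2
      calc C₀ * (K * l + k) ^ 2 ≤ C₀ * ((K + 1) * (l + k)) ^ 2 :=
            mul_le_mul_of_nonneg_left h6 hC₀
        _ = _ := by ring

end CouplingThreshold

theorem theorem2 (U V V' : ℝ → ℝ)
    (hU : CouplingThreshold.IsPotential U) (hV : CouplingThreshold.IsPotential V)
    (hV2 : MemLp V 2 volume) (hV2' : MemLp V' 2 volume)
    (hVV' : CouplingThreshold.HasWeakDeriv V V')
    (u : ℝ → ℝ) (θ : ℝ) (hu : CouplingThreshold.IsNormalizedHalfBoundState U u θ)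
    (α : ℝ → ℝ) (hα : ∀ l : ℝ, 0 < l → 0 < α l)
    (α₀ : ℝ) (hα₀ : 0 < α₀) (hlim : Tendsto α (𝓝[>] 0) (𝓝 α₀))
    (hrate : Tendsto (fun l : ℝ => l ^ (-(1 / 3) : ℝ) * (α l - α₀)) (𝓝[>] 0) atTop)
    (hzero : ∫ x : ℝ, V (α₀ * x) * u x ^ 2 = 0)
    (hneg : ∫ x : ℝ, x * V' (α₀ * x) * u x ^ 2 < 0) :
    CouplingThreshold.HasCouplingConstantThreshold U (fun l x => l * α l * V (α l * x)) ∧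
    ∀ e : ℝ → ℝ,
      CouplingThreshold.IsThresholdEigenvalue U (fun l x => l * α l * V (α l * x)) e →
      ∃ r : ℝ → ℝ, Tendsto r (𝓝[>] 0) (𝓝 0) ∧
        ∀ᶠ l in 𝓝[>] (0 : ℝ),
          e l = -(l ^ 2 * (α l - α₀) ^ 2 *
            ((α₀ / (θ ^ 2 + 1) * ∫ x : ℝ, x * V' (α₀ * x) * u x ^ 2) ^ 2 + r l)) := by
  set I := ∫ x : ℝ, x * V' (α₀ * x) * u x ^ 2 with hI
  set δ : ℝ → ℝ := fun l => α l - α₀ with hδdef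
  have hl : ∀ᶠ l in 𝓝[>] (0 : ℝ), 0 < l := self_mem_nhdsWithin
  have hl0 : Tendsto (fun l : ℝ => l) (𝓝[>] 0) (𝓝 0) := tendsto_id.mono_left nhdsWithin_le_nhds
  have hδ : ∀ᶠ l in 𝓝[>] (0 : ℝ), 0 < δ l := by
    filter_upwards [hrate.eventually_gt_atTop 0, hl] with l h hl
    exact (pos_iff_pos_of_mul_pos h).1 (Real.rpow_pos_of_pos hl _)
  have hδ0 : Tendsto δ (𝓝[>] 0) (𝓝 0) := by simpa [hδdef] using hlim.sub_const α₀
  have hlδ : Tendsto (fun l => l / δ l) (𝓝[>] 0) (𝓝 0) :=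
    CouplingThreshold.tendsto_div_of_rate hrate
  obtain ⟨hθ, ⟨a, ha⟩, C, A, d, hC, hA, hd⟩ :=
    CouplingThreshold.exists_jost_family hU hV hVV' hu hα₀ hlim hδ hzero
  set T := 1 + θ ^ 2 with hT
  have hTpos : 0 < T := by positivity
  set c := -(α₀ * I) / T with hc
  have hcpos : 0 < c := div_pos (neg_pos.2 (mul_neg_of_pos_of_neg hα₀ hneg)) hTpos
  have hcT : α₀ * I = -(c * T) := by rw [hc]; field_simp
  rw [← hI, hcT] at hA
  constructor
  · have hex : ∀ᶠ l in 𝓝[>] (0 : ℝ), ∃ e : ℝ,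
        (-(2 * c * (l * δ l)) ^ 2 ≤ e ∧ e < 0) ∧
        CouplingThreshold.IsEigenvalue (fun x => U x + l * α l * V (α l * x)) e := by
      have e1 := CouplingThreshold.eventually_error_lt hTpos hl hδ hδ0 hlδ hA C
        (x := 2 * c) (by linarith)
      have e2 := CouplingThreshold.eventually_lt_neg_error hTpos hl hδ hδ0 hlδ hA C
        (x := c / 2) (by linarith)
      have e3 : ∀ᶠ l in 𝓝[>] (0 : ℝ), 2 * c * (l * δ l) < 1 := by
        have : Tendsto (fun l => 2 * c * (l * δ l)) (𝓝[>] 0) (𝓝 (2 * c * (0 * 0))) :=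
          (hl0.mul hδ0).const_mul _
        exact this.eventually_lt_const (by simp)
      filter_upwards [e1, e2, e3, hl, hδ, hd] with l e1 e2 e3 hl hδ ⟨hdc, hde, hdx⟩
      have hp : 0 < l * δ l := mul_pos hl hδ
      have hk12 : c / 2 * (l * δ l) ≤ 2 * c * (l * δ l) := by
        refine mul_le_mul_of_nonneg_right ?_ hp.le
        linarith
      have hk1 : 0 < c / 2 * (l * δ l) := by positivity
      have s1 := abs_le.1 (hdx _ hk1.le (hk12.trans e3.le))
      have s2 := abs_le.1 (hdx _ (hk1.le.trans hk12) e3.le)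
      -- the Jost function changes sign between half and twice the predicted value of `k`
      have hc0 : Continuous fun k => θ * d l k := by fun_prop
      obtain ⟨k, hk, hk0⟩ := intermediate_value_Icc hk12 hc0.continuousOn
        (show (0 : ℝ) ∈ _ from ⟨by linarith [s1.2], by linarith [s2.1]⟩)
      have hkpos : 0 < k := hk1.trans_le hk.1
      refine ⟨-k ^ 2, ⟨neg_le_neg (pow_le_pow_left₀ hkpos.le hk.2 2), ?_⟩, (hde k hkpos).2 ?_⟩
      · exact neg_lt_zero.2 (by positivity)
      · exact (mul_eq_zero.1 hk0).resolve_left hθ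
    obtain ⟨e, he⟩ := hex.choice
    have hlow : Tendsto (fun l => -(2 * c * (l * δ l)) ^ 2) (𝓝[>] 0) (𝓝 0) := by
      have : Tendsto (fun l => -(2 * c * (l * δ l)) ^ 2) (𝓝[>] 0)
          (𝓝 (-(2 * c * (0 * 0)) ^ 2)) := (((hl0.mul hδ0).const_mul _).pow 2).neg
      simpa using this
    have he0 : Tendsto e (𝓝[>] 0) (𝓝 0) :=
      tendsto_of_tendsto_of_tendsto_of_le_of_le' hlow tendsto_const_nhds
        (he.mono fun l h => h.1.1) (he.mono fun l h => h.1.2.le)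
    refine ⟨a, ha, e, ⟨he.mono fun l h => ⟨h.1.2, h.2⟩, he0⟩, ?_⟩
    filter_upwards [he, he0.eventually_const_lt ha.1] with l h h' using ⟨h', h.1.2⟩
  · rintro e ⟨he, he0⟩
    set k : ℝ → ℝ := fun l => √(-e l) with hk
    have hk0 : Tendsto k (𝓝[>] 0) (𝓝 0) := by
      have := (Real.continuous_sqrt.tendsto _).comp he0.neg
      rwa [neg_zero, Real.sqrt_zero] at this
    have hkpos : ∀ᶠ l in 𝓝[>] (0 : ℝ), 0 < k l :=
      he.mono fun l h => Real.sqrt_pos.2 (neg_pos.2 h.1)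
    have hke : ∀ᶠ l in 𝓝[>] (0 : ℝ), e l = -k l ^ 2 := he.mono fun l h => by
      rw [hk]; simp only; rw [Real.sq_sqrt (neg_pos.2 h.1).le, neg_neg]
    have hbound : ∀ᶠ l in 𝓝[>] (0 : ℝ), |k l * T + A l| ≤ C * (l + k l) ^ 2 := by
      filter_upwards [he, hke, hkpos, hd, hk0.eventually_lt_const one_pos]
        with l h1 h2 h3 ⟨_, hde, hdx⟩ h4
      have hz : d l (k l) = 0 := (hde _ h3).1 (h2 ▸ h1.2)
      have := hdx _ h3.le h4.le
      rwa [hz, mul_zero, zero_sub, abs_neg] at this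
    have hlimk := CouplingThreshold.tendsto_div_of_abs_le hTpos hC hl hδ hkpos hk0 hlδ hA hbound
    refine ⟨fun l => (k l / (l * δ l)) ^ 2 - c ^ 2, ?_, ?_⟩
    · have := (hlimk.pow 2).sub_const (c ^ 2)
      rwa [sub_self] at this
    · filter_upwards [hl, hδ, hke] with l hl hδ hke
      have e1 : α₀ / (θ ^ 2 + 1) * I = -c := by
        rw [hc, hT, add_comm]; ring
      rw [e1, hke]
      have : α l - α₀ ≠ 0 := hδ.ne'
      simp only [hδdef]
      field_simp
      ring
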